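/- **Corollary (Companions and conjoints of natural transformations, pseudo case).** Let $\mathbb{D}$ and $\mathbb{E}$ be (pseudo) double categories, with arrows composed strictly and proarrows $x \nrightarrow y$ composed up to coherent isomorphism by $\odot$; write $\mathrm{id}_x$ and $\mathrm{id}_f$ for external identities, and $\cdot$ for the internal (strict) composition of cells in diagrammatic order. A *companion* of an arrow $f : x \to y$ is a proarrow $f_! : x \nrightarrow y$ with cells $\eta$ from $\mathrm{id}_x$ (top) to $f_!$ (bottom), with left boundary $1_x$ and right boundary $f$, and $\varepsilon$ from $f_!$ to $\mathrm{id}_y$, with left boundary $f$ and right boundary $1_y$, such that $\eta \odot \varepsilon = 1_{f_!}$ (up to the unit isomorphisms) and $\eta \cdot \varepsilon = \mathrm{id}_f$. Dually, a *conjoint* of $f$ is a proarrow $f^* : y \nrightarrow x$ with cells $\eta$ from $\mathrm{id}_x$ to $f^*$ (left boundary $f$, right boundary $1_x$) and $\varepsilon$ from $f^*$ to $\mathrm{id}_y$ (left boundary $1_y$, right boundary $f$) such that $\varepsilon \odot \eta = 1_{f^*}$ (up to the unit isomorphisms) and $\eta \cdot \varepsilon = \mathrm{id}_f$. Let $\theta$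 be a cell with top $m : x \nrightarrow y$, bottom $n : w \nrightarrow z$, left boundary $f : x \to w$ and right boundary $g : y \to z$. It is a *commuter* if $f$ and $g$ have companions and the globular cell $\theta_! : m \odot g_! \to f_! \odot n$ given, up to unit isomorphisms, by $\eta_f \odot \theta \odot \varepsilon_g$ is an isomorphism (for any choice of companions). It is a *cocommuter* if $f$ and $g$ have conjoints and the globular cell $\theta^* : f^* \odot m \to n \odot g^*$ given, up to unit isomorphisms, by $\varepsilon_f \odot \theta \odot \eta_g$ is an isomorphism (for any choice of conjoints). Let $\mathrm{Lax}_{\mathrm{ps}}(\mathbb{D},\mathbb{E})$ be the double category whose objects are lax double functors $\mathbb{D} \to \mathbb{E}$, whose arrows are (strict) natural transformations, whose proarrows $F \nrightarrow G$ are pseudo protransformations, and whose cells are modifications, composed componentwise. Here a pseudo protransformation $\tau : F \nrightarrow G$ consists of proarrows $\tau_x : Fx \nrightarrow Gx$, cells $\tau_f$ from $\tau_x$ to $\tau_y$ with left boundary $Ff$ and right boundary $Gf$, functorial in $f : x \to y$, and invertible globular cells $\tau_m : \tau_x \odot Gm \to Fm \odot \tau_y$ for proarrows $m : x \nrightarrow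 y$, natural with respect to cells and coherent with respect to external composition and identities. A modification with top $\sigma : F \nrightarrow G$, bottom $\tau : H \nrightarrow K$, left boundary $\alpha : F \Rightarrow H$ and right boundary $\beta : G \Rightarrow K$ consists of cells $\mu_x$ from $\sigma_x$ to $\tau_x$ with left boundary $\alpha_x$ and right boundary $\beta_x$, such that $\mu_x \cdot \tau_f = \sigma_f \cdot \mu_y$ for every arrow $f : x \to y$ and $(\mu_x \odot \beta_m) \cdot \tau_m = \sigma_m \cdot (\alpha_m \odot \mu_y)$ for every proarrow $m : x \nrightarrow y$. Let $\alpha : F \Rightarrow G$ be a natural transformation between lax double functors $F, G : \mathbb{D} \to \mathbb{E}$. Then: 1. $\alpha$ has a companion in $\mathrm{Lax}_{\mathrm{ps}}(\mathbb{D},\mathbb{E})$, which is a pseudo protransformation $\alpha_! : F \nrightarrow G$, if and only if for every object $x$ of $\mathbb{D}$ the component arrow $\alpha_x : Fx \to Gx$ has a companion in $\mathbb{E}$ and for every proarrow $m$ of $\mathbb{D}$ the component cell $\alpha_m$ is a commuter. 2. $\alpha$ has a conjoint in $\mathrm{Lax}_{\mathrm{ps}}(\mathbb{D},\mathbb{E})$,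 which is a pseudo protransformation $\alpha^* : G \nrightarrow F$, if and only if for every object $x$ of $\mathbb{D}$ the component arrow $\alpha_x$ has a conjoint in $\mathbb{E}$ and for every proarrow $m$ of $\mathbb{D}$ the component cell $\alpha_m$ is a cocommuter. -/

import Mathlib

open CategoryTheory

universe t w v u t₁ w₁ v₁ u₁ t₂ w₂ v₂ u₂

namespace DoubleCat

/-- A proarrow together with its two endpoints: an object of the category `D₁`. -/
structure Loose {D : Type u} (Pro : D → D → Type w) where
  {dom : D}
  {cod : D}
  pro : Pro dom cod

set_option linter.checkUnivs false

/-- The two categories `D₀` (objects and arrows) and `D₁` (proarrows and cells) of a double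
category, with the source and target functors `D₁ ⇉ D₀`. -/
class PreDoubleCategory (D : Type u) extends Category.{v} D where
  /-- the proarrows -/
  Pro : D → D → Type w
  /-- the category `D₁`; its morphisms are the cells -/
  cellCategory : Category.{t} (Loose Pro)
  src : ∀ {P Q : Loose Pro}, (P ⟶ Q) → (P.dom ⟶ Q.dom)
  tgt : ∀ {P Q : Loose Pro}, (P ⟶ Q) → (P.cod ⟶ Q.cod)
  src_id : ∀ P : Loose Pro, src (𝟙 P) = 𝟙 P.dom
  tgt_id : ∀ P : Loose Pro, tgt (𝟙 P) = 𝟙 P.cod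
  src_comp : ∀ {P Q R : Loose Pro} (α : P ⟶ Q) (β : Q ⟶ R), src (α ≫ β) = src α ≫ src β
  tgt_comp : ∀ {P Q R : Loose Pro} (α : P ⟶ Q) (β : Q ⟶ R), tgt (α ≫ β) = tgt α ≫ tgt β

open PreDoubleCategory

/-- `x ⇸ y` is the type of proarrows from `x` to `y`. -/
infix:26 " ⇸ " => PreDoubleCategory.Pro

attribute [reducible, instance] PreDoubleCategory.cellCategory
attribute [simp] src_id tgt_id src_comp tgt_comp

/-- Cells with top `m` and bottom `n`.  The left and right boundary arrows of a cell `α` are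
`src α` and `tgt α`; internal (vertical) composition of cells is `≫`. -/
abbrev Cell {D : Type u} [PreDoubleCategory.{t, w, v} D] {x y x' y' : D}
    (m : x ⇸ y) (n : x' ⇸ y') : Type t :=
  (Loose.mk m : Loose (D := D) Pro) ⟶ Loose.mk n

/-- Globular cells: both boundary arrows are identities. -/
@[ext]
structure Glob {D : Type u} [PreDoubleCategory.{t, w, v} D] {x y : D} (m n : x ⇸ y) :
    Type t where
  cell : Cell m n
  src_cell : src cell = 𝟙 x
  tgt_cell : tgt cell = 𝟙 y

attribute [simp] Glob.src_cell Glob.tgt_cell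

/-- Proarrows `x ⇸ y` and globular cells form a category, written `m ⟶ n`.  A globular cell is
invertible here exactly if it is invertible in `D₁`. -/
instance globCategory {D : Type u} [PreDoubleCategory.{t, w, v} D] (x y : D) :
    Category.{t} (x ⇸ y) where
  Hom m n := Glob m n
  id m := ⟨𝟙 (Loose.mk m), src_id _, tgt_id _⟩
  comp α β := ⟨α.cell ≫ β.cell, by simp, by simp⟩
  id_comp α := Glob.ext (Category.id_comp _)
  comp_id α := Glob.ext (Category.comp_id _)
  assoc α β γ := Glob.ext (Category.assoc _ _ _)

section
variable {D : Type u} [PreDoubleCategory.{t, w, v} D] {x y : D}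

@[ext]
theorem glob_ext {m n : x ⇸ y} {α β : m ⟶ n} (h : α.cell = β.cell) : α = β := Glob.ext h

@[simp]
theorem glob_id_cell (m : x ⇸ y) : Glob.cell (𝟙 m) = 𝟙 (Loose.mk m) := rfl

@[simp]
theorem glob_comp_cell {m n p : x ⇸ y} (α : m ⟶ n) (β : n ⟶ p) :
    Glob.cell (α ≫ β) = Glob.cell α ≫ Glob.cell β := rfl

theorem frame_id_id {z : D} (m : x ⇸ y) (n : y ⇸ z) :
    tgt (𝟙 (Loose.mk m)) = src (𝟙 (Loose.mk n)) := by simp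

theorem frame_id_glob {z : D} (m : x ⇸ y) {n n' : y ⇸ z} (β : n ⟶ n') :
    tgt (𝟙 (Loose.mk m)) = src β.cell := by simp

theorem frame_glob_id {z : D} {m m' : x ⇸ y} (α : m ⟶ m') (n : y ⇸ z) :
    tgt α.cell = src (𝟙 (Loose.mk n)) := by simp

theorem frame_comp {x y z x' y' z' x'' y'' z'' : D} {m : x ⇸ y} {n : y ⇸ z}
    {m' : x' ⇸ y'} {n' : y' ⇸ z'} {m'' : x'' ⇸ y''} {n'' : y'' ⇸ z''}
    (α : Cell m m') (β : Cell n n') (α' : Cell m' m'') (β' : Cell n' n'')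
    (h : tgt α = src β) (h' : tgt α' = src β') : tgt (α ≫ α') = src (β ≫ β') := by
  simp [h, h']

end

/-- A (pseudo) double category: a pair `D₁ ⇉ D₀` with external identities and external
composition that are functorial, and that are associative and unital up to coherent globular
isomorphism. -/
class DoubleCategory (D : Type u) extends PreDoubleCategory.{t, w, v} D where
  /-- external identities -/
  hid : ∀ x : D, x ⇸ x
  hidMap : ∀ {x y : D}, (x ⟶ y) → Cell (hid x) (hid y)
  src_hidMap : ∀ {x y : D} (f : x ⟶ y), src (hidMap f) = f
  tgt_hidMap : ∀ {x y : D} (f : x ⟶ y), tgt (hidMap f) = f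
  hidMap_id : ∀ x : D, hidMap (𝟙 x) = 𝟙 (Loose.mk (hid x))
  hidMap_comp : ∀ {x y z : D} (f : x ⟶ y) (g : y ⟶ z), hidMap (f ≫ g) = hidMap f ≫ hidMap g
  /-- external composition of proarrows -/
  hcomp : ∀ {x y z : D}, x ⇸ y → y ⇸ z → x ⇸ z
  /-- external composition of cells with a common boundary arrow -/
  hcompMap : ∀ {x y z x' y' z' : D} {m : x ⇸ y} {n : y ⇸ z} {m' : x' ⇸ y'} {n' : y' ⇸ z'}
    (α : Cell m m') (β : Cell n n'), tgt α = src β → Cell (hcomp m n) (hcomp m' n')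
  src_hcompMap : ∀ {x y z x' y' z' : D} {m : x ⇸ y} {n : y ⇸ z} {m' : x' ⇸ y'}
    {n' : y' ⇸ z'} (α : Cell m m') (β : Cell n n') (h : tgt α = src β),
    src (hcompMap α β h) = src α
  tgt_hcompMap : ∀ {x y z x' y' z' : D} {m : x ⇸ y} {n : y ⇸ z} {m' : x' ⇸ y'}
    {n' : y' ⇸ z'} (α : Cell m m') (β : Cell n n') (h : tgt α = src β),
    tgt (hcompMap α β h) = tgt β
  hcompMap_id : ∀ {x y z : D} (m : x ⇸ y) (n : y ⇸ z),
    hcompMap (𝟙 (Loose.mk m)) (𝟙 (Loose.mk n)) (frame_id_id m n) = 𝟙 (Loose.mk (hcomp m n))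
  hcompMap_comp : ∀ {x y z x' y' z' x'' y'' z'' : D} {m : x ⇸ y} {n : y ⇸ z}
    {m' : x' ⇸ y'} {n' : y' ⇸ z'} {m'' : x'' ⇸ y''} {n'' : y'' ⇸ z''}
    (α : Cell m m') (β : Cell n n') (α' : Cell m' m'') (β' : Cell n' n'')
    (h : tgt α = src β) (h' : tgt α' = src β'),
    hcompMap (α ≫ α') (β ≫ β') (frame_comp α β α' β' h h') = hcompMap α β h ≫ hcompMap α' β' h'
  /-- associators and unitors, natural globular isomorphisms -/
  hassoc : ∀ {x y z s : D} (m : x ⇸ y) (n : y ⇸ z) (p : z ⇸ s),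
    hcomp (hcomp m n) p ≅ hcomp m (hcomp n p)
  hassoc_naturality : ∀ {x y z s x' y' z' s' : D} {m : x ⇸ y} {n : y ⇸ z} {p : z ⇸ s}
    {m' : x' ⇸ y'} {n' : y' ⇸ z'} {p' : z' ⇸ s'}
    (α : Cell m m') (β : Cell n n') (γ : Cell p p') (h : tgt α = src β) (h' : tgt β = src γ),
    hcompMap (hcompMap α β h) γ ((tgt_hcompMap α β h).trans h') ≫ (hassoc m' n' p').hom.cell =
      (hassoc m n p).hom.cell ≫ hcompMap α (hcompMap β γ h') (h.trans (src_hcompMap β γ h').symm)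
  leftUnitor : ∀ {x y : D} (m : x ⇸ y), hcomp (hid x) m ≅ m
  leftUnitor_naturality : ∀ {x y x' y' : D} {m : x ⇸ y} {n : x' ⇸ y'} (α : Cell m n),
    hcompMap (hidMap (src α)) α (tgt_hidMap _) ≫ (leftUnitor n).hom.cell =
      (leftUnitor m).hom.cell ≫ α
  rightUnitor : ∀ {x y : D} (m : x ⇸ y), hcomp m (hid y) ≅ m
  rightUnitor_naturality : ∀ {x y x' y' : D} {m : x ⇸ y} {n : x' ⇸ y'} (α : Cell m n),
    hcompMap α (hidMap (tgt α)) (src_hidMap _).symm ≫ (rightUnitor n).hom.cell =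
      (rightUnitor m).hom.cell ≫ α
  pentagon : ∀ {x y z s r : D} (m : x ⇸ y) (n : y ⇸ z) (p : z ⇸ s) (q : s ⇸ r),
    hcompMap (hassoc m n p).hom.cell (𝟙 (Loose.mk q)) (frame_glob_id _ q) ≫
        (hassoc m (hcomp n p) q).hom.cell ≫
          hcompMap (𝟙 (Loose.mk m)) (hassoc n p q).hom.cell (frame_id_glob m _) =
      (hassoc (hcomp m n) p q).hom.cell ≫ (hassoc m n (hcomp p q)).hom.cell
  triangle : ∀ {x y z : D} (m : x ⇸ y) (n : y ⇸ z),
    (hassoc m (hid y) n).hom.cell ≫ hcompMap (𝟙 (Loose.mk m)) (leftUnitor n).hom.cell (frame_id_glob m _) =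
      hcompMap (rightUnitor m).hom.cell (𝟙 (Loose.mk n)) (frame_glob_id _ n)

open DoubleCategory

attribute [simp] src_hidMap tgt_hidMap src_hcompMap tgt_hcompMap

/-- External composition, written in diagrammatic order. -/
infixl:70 " ⊙ " => DoubleCategory.hcomp

section
variable {D : Type u} [DoubleCategory.{t, w, v} D]

/-- Whiskering of a globular cell by a proarrow on the left, `1_m ⊙ β`. -/
def whiskerL {x y z : D} (m : x ⇸ y) {n n' : y ⇸ z} (β : n ⟶ n') : m ⊙ n ⟶ m ⊙ n' :=
  ⟨hcompMap (𝟙 (Loose.mk m)) β.cell (frame_id_glob m β), by simp, by simp⟩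

/-- Whiskering of a globular cell by a proarrow on the right, `α ⊙ 1_n`. -/
def whiskerR {x y z : D} {m m' : x ⇸ y} (α : m ⟶ m') (n : y ⇸ z) : m ⊙ n ⟶ m' ⊙ n :=
  ⟨hcompMap α.cell (𝟙 (Loose.mk n)) (frame_glob_id α n), by simp, by simp⟩

infixr:81 " ◁ₚ " => whiskerL
infixl:81 " ▷ₚ " => whiskerR

theorem hcompMap_congr {x y z x' y' z' : D} {m : x ⇸ y} {n : y ⇸ z} {m' : x' ⇸ y'}
    {n' : y' ⇸ z'} {α α' : Cell m m'} {β β' : Cell n n'} {h : tgt α = src β}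
    (hα : α = α') (hβ : β = β') :
    hcompMap α β h = hcompMap α' β' (by rw [← hα, ← hβ, h]) := by
  subst hα hβ; rfl

theorem whiskerL_id {x y z : D} (m : x ⇸ y) (n : y ⇸ z) : m ◁ₚ 𝟙 n = 𝟙 (m ⊙ n) :=
  glob_ext (hcompMap_id _ _)

theorem id_whiskerR {x y z : D} (m : x ⇸ y) (n : y ⇸ z) : 𝟙 m ▷ₚ n = 𝟙 (m ⊙ n) :=
  glob_ext (hcompMap_id _ _)

theorem whiskerL_comp {x y z : D} (m : x ⇸ y) {n n' n'' : y ⇸ z} (β : n ⟶ n')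
    (γ : n' ⟶ n'') : m ◁ₚ (β ≫ γ) = m ◁ₚ β ≫ m ◁ₚ γ := by
  apply glob_ext
  refine Eq.trans ?_ (hcompMap_comp _ _ _ _ _ _)
  exact hcompMap_congr (Category.comp_id _).symm rfl

theorem comp_whiskerR {x y z : D} {m m' m'' : x ⇸ y} (α : m ⟶ m') (β : m' ⟶ m'')
    (n : y ⇸ z) : (α ≫ β) ▷ₚ n = α ▷ₚ n ≫ β ▷ₚ n := by
  apply glob_ext
  refine Eq.trans ?_ (hcompMap_comp _ _ _ _ _ _)
  exact hcompMap_congr rfl (Category.comp_id _).symm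

theorem id_whiskerL {x y : D} {m n : x ⇸ y} (α : m ⟶ n) :
    hid x ◁ₚ α = (leftUnitor m).hom ≫ α ≫ (leftUnitor n).inv := by
  rw [← Category.assoc, Iso.eq_comp_inv]
  ext
  have := leftUnitor_naturality (α.cell)
  simp only [glob_comp_cell, ← this, whiskerL]
  congr 1
  exact hcompMap_congr (by simp [hidMap_id]) rfl

theorem whiskerR_id {x y : D} {m n : x ⇸ y} (α : m ⟶ n) :
    α ▷ₚ hid y = (rightUnitor m).hom ≫ α ≫ (rightUnitor n).inv := by
  rw [← Category.assoc, Iso.eq_comp_inv]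
  ext
  have := rightUnitor_naturality (α.cell)
  simp only [glob_comp_cell, ← this, whiskerR]
  congr 1
  exact hcompMap_congr rfl (by simp [hidMap_id])

theorem comp_whiskerL {x y z s : D} (m : x ⇸ y) (n : y ⇸ z) {p p' : z ⇸ s} (β : p ⟶ p') :
    (m ⊙ n) ◁ₚ β = (hassoc m n p).hom ≫ m ◁ₚ n ◁ₚ β ≫ (hassoc m n p').inv := by
  rw [← Category.assoc, Iso.eq_comp_inv]
  apply glob_ext
  refine Eq.trans ?_ (hassoc_naturality _ _ _ (frame_id_id _ _) (frame_id_glob _ _))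
  exact congrArg (· ≫ _) (hcompMap_congr (hcompMap_id _ _).symm rfl)

theorem whiskerR_comp {x y z s : D} {m m' : x ⇸ y} (α : m ⟶ m') (n : y ⇸ z) (p : z ⇸ s) :
    α ▷ₚ (n ⊙ p) = (hassoc m n p).inv ≫ α ▷ₚ n ▷ₚ p ≫ (hassoc m' n p).hom := by
  rw [Iso.eq_inv_comp]
  apply glob_ext
  refine Eq.trans ?_ (hassoc_naturality _ _ _ (frame_glob_id _ _) (frame_id_id _ _)).symm
  exact congrArg (_ ≫ ·) (hcompMap_congr rfl (hcompMap_id _ _).symm)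

theorem whisker_assoc {x y z s : D} (m : x ⇸ y) {n n' : y ⇸ z} (β : n ⟶ n') (p : z ⇸ s) :
    (m ◁ₚ β) ▷ₚ p = (hassoc m n p).hom ≫ m ◁ₚ β ▷ₚ p ≫ (hassoc m n' p).inv := by
  rw [← Category.assoc, Iso.eq_comp_inv]
  apply glob_ext
  exact hassoc_naturality _ _ _ (frame_id_glob _ _) (frame_glob_id _ _)

theorem whisker_exchange {x y z : D} {m m' : x ⇸ y} {n n' : y ⇸ z} (α : m ⟶ m')
    (β : n ⟶ n') : m ◁ₚ β ≫ α ▷ₚ n' = α ▷ₚ n ≫ m' ◁ₚ β := by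
  apply glob_ext
  refine (hcompMap_comp _ _ _ _ _ _).symm.trans (Eq.trans ?_ (hcompMap_comp _ _ _ _ _ _))
  exact hcompMap_congr (by simp) (by simp)

/-- The type of objects of `D`, regarded as the objects of its underlying bicategory. -/
def UBicat (D : Type u) : Type u := D

/-- The underlying bicategory of a double category: objects, proarrows and globular cells. -/
instance : Bicategory.{t, w} (UBicat D) where
  Hom x y := PreDoubleCategory.Pro (D := D) x y
  id x := hid (D := D) x
  comp m n := hcomp (D := D) m n
  homCategory x y := globCategory (D := D) x y
  whiskerLeft m _ _ β := whiskerL (D := D) m β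
  whiskerRight α n := whiskerR (D := D) α n
  associator m n p := DoubleCategory.hassoc (D := D) m n p
  leftUnitor m := DoubleCategory.leftUnitor (D := D) m
  rightUnitor m := DoubleCategory.rightUnitor (D := D) m
  whiskerLeft_id m n := whiskerL_id (D := D) m n
  whiskerLeft_comp m _ _ _ β γ := whiskerL_comp (D := D) m β γ
  id_whiskerLeft β := id_whiskerL (D := D) β
  comp_whiskerLeft m n _ _ β := comp_whiskerL (D := D) m n β
  id_whiskerRight m n := id_whiskerR (D := D) m n
  comp_whiskerRight β γ n := comp_whiskerR (D := D) β γ n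
  whiskerRight_id β := whiskerR_id (D := D) β
  whiskerRight_comp β n p := whiskerR_comp (D := D) β n p
  whisker_assoc m _ _ β p := whisker_assoc (D := D) m β p
  whisker_exchange α β := whisker_exchange (D := D) α β
  pentagon _ _ _ _ := glob_ext (D := D) (DoubleCategory.pentagon _ _ _ _)
  triangle _ _ := glob_ext (D := D) (DoubleCategory.triangle _ _)

instance isIso_whiskerL {x y z : D} (m : x ⇸ y) {n n' : y ⇸ z} (β : n ⟶ n') [IsIso β] :
    IsIso (m ◁ₚ β) :=
  ⟨m ◁ₚ inv β, by rw [← whiskerL_comp, IsIso.hom_inv_id, whiskerL_id],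
    by rw [← whiskerL_comp, IsIso.inv_hom_id, whiskerL_id]⟩

instance isIso_whiskerR {x y z : D} {m m' : x ⇸ y} (α : m ⟶ m') [IsIso α] (n : y ⇸ z) :
    IsIso (α ▷ₚ n) :=
  ⟨inv α ▷ₚ n, by rw [← comp_whiskerR, IsIso.hom_inv_id, id_whiskerR],
    by rw [← comp_whiskerR, IsIso.inv_hom_id, id_whiskerR]⟩

end

/-! ### Companions, conjoints, commuters -/

section
variable {D : Type u} [DoubleCategory.{t, w, v} D]

/-- A companion of the arrow `f`: a proarrow `f_! : x ⇸ y` with unit and counit cells. -/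
structure Companion {x y : D} (f : x ⟶ y) where
  pro : x ⇸ y
  unit : Cell (hid x) pro
  src_unit : src unit = 𝟙 x
  tgt_unit : tgt unit = f
  counit : Cell pro (hid y)
  src_counit : src counit = f
  tgt_counit : tgt counit = 𝟙 y
  /-- `η ⊙ ε = 1`, up to the unit isomorphisms -/
  unit_hcomp_counit :
    (leftUnitor pro).inv.cell ≫ hcompMap unit counit (tgt_unit.trans src_counit.symm) ≫
      (rightUnitor pro).hom.cell = 𝟙 (Loose.mk pro)
  /-- `η ⬝ ε = id_f` -/
  unit_comp_counit : unit ≫ counit = hidMap f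

/-- A conjoint of the arrow `f`: a proarrow `f^* : y ⇸ x` with unit and counit cells. -/
structure Conjoint {x y : D} (f : x ⟶ y) where
  pro : y ⇸ x
  unit : Cell (hid x) pro
  src_unit : src unit = f
  tgt_unit : tgt unit = 𝟙 x
  counit : Cell pro (hid y)
  src_counit : src counit = 𝟙 y
  tgt_counit : tgt counit = f
  /-- `ε ⊙ η = 1`, up to the unit isomorphisms -/
  counit_hcomp_unit :
    (rightUnitor pro).inv.cell ≫ hcompMap counit unit (tgt_counit.trans src_unit.symm) ≫
      (leftUnitor pro).hom.cell = 𝟙 (Loose.mk pro)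
  /-- `η ⬝ ε = id_f` -/
  unit_comp_counit : unit ≫ counit = hidMap f

def HasCompanion {x y : D} (f : x ⟶ y) : Prop := Nonempty (Companion f)

def HasConjoint {x y : D} (f : x ⟶ y) : Prop := Nonempty (Conjoint f)

/-- The globular cell `α_! : m ⊙ g_! ⟶ f_! ⊙ n` obtained by sliding the boundary arrows
`f`, `g` of a cell `α` along companions: the external composite `η_f ⊙ α ⊙ ε_g`. -/
def slideCompanion {x y x' y' : D} {m : x ⇸ y} {n : x' ⇸ y'} {f : x ⟶ x'} {g : y ⟶ y'}
    (cf : Companion f) (cg : Companion g) (α : Cell m n) (hf : src α = f) (hg : tgt α = g) :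
    m ⊙ cg.pro ⟶ cf.pro ⊙ n :=
  (leftUnitor m).inv ▷ₚ cg.pro ≫
    (⟨hcompMap (hcompMap cf.unit α (cf.tgt_unit.trans hf.symm)) cg.counit
        ((tgt_hcompMap _ _ _).trans (hg.trans cg.src_counit.symm)),
      by rw [src_hcompMap, src_hcompMap, cf.src_unit],
      by rw [tgt_hcompMap, cg.tgt_counit]⟩ :
      hid x ⊙ m ⊙ cg.pro ⟶ cf.pro ⊙ n ⊙ hid y') ≫
    (rightUnitor (cf.pro ⊙ n)).hom

/-- The globular cell `α^* : f^* ⊙ m ⟶ n ⊙ g^*` obtained by sliding the boundary arrows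
`f`, `g` of a cell `α` along conjoints: the external composite `ε_f ⊙ α ⊙ η_g`. -/
def slideConjoint {x y x' y' : D} {m : x ⇸ y} {n : x' ⇸ y'} {f : x ⟶ x'} {g : y ⟶ y'}
    (cf : Conjoint f) (cg : Conjoint g) (α : Cell m n) (hf : src α = f) (hg : tgt α = g) :
    cf.pro ⊙ m ⟶ n ⊙ cg.pro :=
  cf.pro ◁ₚ (rightUnitor m).inv ≫
    (⟨hcompMap cf.counit (hcompMap α cg.unit (hg.trans cg.src_unit.symm))
        ((cf.tgt_counit.trans hf.symm).trans (src_hcompMap _ _ _).symm),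
      by rw [src_hcompMap, cf.src_counit],
      by rw [tgt_hcompMap, tgt_hcompMap, cg.tgt_unit]⟩ :
      cf.pro ⊙ (m ⊙ hid y) ⟶ hid x' ⊙ (n ⊙ cg.pro)) ≫
    (leftUnitor (n ⊙ cg.pro)).hom

/-- A cell is a commuter if its boundary arrows have companions and `α_!` is an isomorphism
(for any choice of companions). -/
def IsCommuter {x y x' y' : D} {m : x ⇸ y} {n : x' ⇸ y'} (α : Cell m n) : Prop :=
  HasCompanion (src α) ∧ HasCompanion (tgt α) ∧
    ∀ (cf : Companion (src α)) (cg : Companion (tgt α)),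
      IsIso (slideCompanion cf cg α rfl rfl)

/-- A cell is a cocommuter if its boundary arrows have conjoints and `α^*` is an isomorphism
(for any choice of conjoints). -/
def IsCocommuter {x y x' y' : D} {m : x ⇸ y} {n : x' ⇸ y'} (α : Cell m n) : Prop :=
  HasConjoint (src α) ∧ HasConjoint (tgt α) ∧
    ∀ (cf : Conjoint (src α)) (cg : Conjoint (tgt α)),
      IsIso (slideConjoint cf cg α rfl rfl)

end

/-! ### Lax double functors, transformations, protransformations, modifications -/

section
variable (D : Type u₁) [DoubleCategory.{t₁, w₁, v₁} D]
variable (E : Type u₂) [DoubleCategory.{t₂, w₂, v₂} E]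

/-- A lax double functor: functors on `D₀` and `D₁` compatible with sources and targets,
with natural, coherent globular comparison cells `F_{m,n}` and `F_x`. -/
structure LaxDoubleFunctor extends D ⥤ E where
  mapPro : ∀ {x y : D}, (x ⇸ y) → (obj x ⇸ obj y)
  mapCell : ∀ {x y x' y' : D} {m : x ⇸ y} {n : x' ⇸ y'},
    Cell m n → Cell (mapPro m) (mapPro n)
  src_mapCell : ∀ {x y x' y' : D} {m : x ⇸ y} {n : x' ⇸ y'} (α : Cell m n),
    src (mapCell α) = map (src α)
  tgt_mapCell : ∀ {x y x' y' : D} {m : x ⇸ y} {n : x' ⇸ y'} (α : Cell m n),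
    tgt (mapCell α) = map (tgt α)
  mapCell_id : ∀ {x y : D} (m : x ⇸ y), mapCell (𝟙 (Loose.mk m)) = 𝟙 (Loose.mk (mapPro m))
  mapCell_comp : ∀ {x y x' y' x'' y'' : D} {m : x ⇸ y} {n : x' ⇸ y'} {p : x'' ⇸ y''}
    (α : Cell m n) (β : Cell n p), mapCell (α ≫ β) = mapCell α ≫ mapCell β
  /-- the laxator `F_{m,n}` -/
  laxComp : ∀ {x y z : D} (m : x ⇸ y) (n : y ⇸ z), mapPro m ⊙ mapPro n ⟶ mapPro (m ⊙ n)
  /-- the laxator `F_x` -/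
  laxId : ∀ x : D, hid (obj x) ⟶ mapPro (hid x)
  laxComp_naturality : ∀ {x y z x' y' z' : D} {m : x ⇸ y} {n : y ⇸ z} {m' : x' ⇸ y'}
    {n' : y' ⇸ z'} (α : Cell m m') (β : Cell n n') (h : tgt α = src β),
    hcompMap (mapCell α) (mapCell β) (by rw [tgt_mapCell, src_mapCell, h]) ≫
        (laxComp m' n').cell =
      (laxComp m n).cell ≫ mapCell (hcompMap α β h)
  laxId_naturality : ∀ {x y : D} (f : x ⟶ y),
    hidMap (map f) ≫ (laxId y).cell = (laxId x).cell ≫ mapCell (hidMap f)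
  laxComp_hassoc : ∀ {x y z s : D} (m : x ⇸ y) (n : y ⇸ z) (p : z ⇸ s),
    (laxComp m n ▷ₚ mapPro p ≫ laxComp (m ⊙ n) p).cell ≫ mapCell (hassoc m n p).hom.cell =
      ((hassoc _ _ _).hom ≫ mapPro m ◁ₚ laxComp n p ≫ laxComp m (n ⊙ p)).cell
  laxComp_leftUnitor : ∀ {x y : D} (m : x ⇸ y),
    (laxId x ▷ₚ mapPro m ≫ laxComp (hid x) m).cell ≫ mapCell (leftUnitor m).hom.cell =
      (leftUnitor (mapPro m)).hom.cell
  laxComp_rightUnitor : ∀ {x y : D} (m : x ⇸ y),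
    (mapPro m ◁ₚ laxId y ≫ laxComp m (hid y)).cell ≫ mapCell (rightUnitor m).hom.cell =
      (rightUnitor (mapPro m)).hom.cell

end

section
variable {D : Type u₁} [DoubleCategory.{t₁, w₁, v₁} D]
variable {E : Type u₂} [DoubleCategory.{t₂, w₂, v₂} E]

attribute [simp] LaxDoubleFunctor.src_mapCell LaxDoubleFunctor.tgt_mapCell

/-- A (tight, strict) natural transformation between lax double functors. -/
structure NatTransf (F G : LaxDoubleFunctor D E) where
  app : ∀ x : D, F.obj x ⟶ G.obj x
  naturality : ∀ {x y : D} (f : x ⟶ y), F.map f ≫ app y = app x ≫ G.map f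
  /-- the component `α_m` at a proarrow `m` -/
  cell : ∀ {x y : D} (m : x ⇸ y), Cell (F.mapPro m) (G.mapPro m)
  src_cell : ∀ {x y : D} (m : x ⇸ y), src (cell m) = app x
  tgt_cell : ∀ {x y : D} (m : x ⇸ y), tgt (cell m) = app y
  cell_naturality : ∀ {x y x' y' : D} {m : x ⇸ y} {n : x' ⇸ y'} (γ : Cell m n),
    F.mapCell γ ≫ cell n = cell m ≫ G.mapCell γ
  cell_hcomp : ∀ {x y z : D} (m : x ⇸ y) (n : y ⇸ z),
    (F.laxComp m n).cell ≫ cell (m ⊙ n) =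
      hcompMap (cell m) (cell n) (by rw [tgt_cell, src_cell]) ≫ (G.laxComp m n).cell
  cell_hid : ∀ x : D,
    (F.laxId x).cell ≫ cell (hid x) = hidMap (app x) ≫ (G.laxId x).cell

attribute [simp] NatTransf.src_cell NatTransf.tgt_cell

theorem NatTransf.ext' {F G : LaxDoubleFunctor D E} {α β : NatTransf F G}
    (happ : ∀ x, α.app x = β.app x) (hcell : ∀ {x y : D} (m : x ⇸ y), α.cell m = β.cell m) :
    α = β := by
  cases α; cases β
  congr
  · exact funext happ
  · funext x y m; exact hcell m

/-- Lax double functors `D → E` and natural transformations form a category. -/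
instance : Category.{max u₁ w₁ v₂ t₂} (LaxDoubleFunctor D E) where
  Hom F G := NatTransf F G
  id F :=
    { app := fun x => 𝟙 (F.obj x)
      naturality := by simp
      cell := fun m => 𝟙 (Loose.mk (F.mapPro m))
      src_cell := by simp
      tgt_cell := by simp
      cell_naturality := fun γ => by rw [Category.comp_id, Category.id_comp]
      cell_hcomp := fun m n => by rw [hcompMap_id, Category.comp_id, Category.id_comp]
      cell_hid := fun x => by rw [hidMap_id, Category.comp_id, Category.id_comp] }
  comp {F G H} α β :=
    { app := fun x => α.app x ≫ β.app x
      naturality := fun f => by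
        rw [← Category.assoc, α.naturality, Category.assoc, β.naturality, Category.assoc]
      cell := fun m => α.cell m ≫ β.cell m
      src_cell := by simp
      tgt_cell := by simp
      cell_naturality := fun γ => by
        rw [← Category.assoc, α.cell_naturality, Category.assoc, β.cell_naturality,
          Category.assoc]
      cell_hcomp := fun m n => by
        rw [← Category.assoc, α.cell_hcomp, Category.assoc, β.cell_hcomp, ← Category.assoc,
          hcompMap_comp]
      cell_hid := fun x => by
        rw [← Category.assoc, α.cell_hid, Category.assoc, β.cell_hid, ← Category.assoc,
          hidMap_comp] }
  id_comp α := NatTransf.ext' (fun _ => Category.id_comp _) (fun _ => Category.id_comp _)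
  comp_id α := NatTransf.ext' (fun _ => Category.comp_id _) (fun _ => Category.comp_id _)
  assoc α β γ :=
    NatTransf.ext' (fun _ => Category.assoc _ _ _) (fun _ => Category.assoc _ _ _)

/-- A lax protransformation `F ⇸ G`. -/
structure LaxProtransf (F G : LaxDoubleFunctor D E) where
  pro : ∀ x : D, F.obj x ⇸ G.obj x
  /-- the component at an arrow -/
  arr : ∀ {x y : D}, (x ⟶ y) → Cell (pro x) (pro y)
  src_arr : ∀ {x y : D} (f : x ⟶ y), src (arr f) = F.map f
  tgt_arr : ∀ {x y : D} (f : x ⟶ y), tgt (arr f) = G.map f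
  /-- the naturality comparison at a proarrow -/
  comparison : ∀ {x y : D} (m : x ⇸ y), pro x ⊙ G.mapPro m ⟶ F.mapPro m ⊙ pro y
  arr_id : ∀ x : D, arr (𝟙 x) = 𝟙 (Loose.mk (pro x))
  arr_comp : ∀ {x y z : D} (f : x ⟶ y) (g : y ⟶ z), arr (f ≫ g) = arr f ≫ arr g
  naturality : ∀ {x y x' y' : D} {m : x ⇸ y} {n : x' ⇸ y'} (γ : Cell m n),
    (comparison m).cell ≫
        hcompMap (F.mapCell γ) (arr (tgt γ)) (by rw [F.tgt_mapCell, src_arr]) =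
      hcompMap (arr (src γ)) (G.mapCell γ) (by rw [G.src_mapCell, tgt_arr]) ≫
        (comparison n).cell
  comparison_hcomp : ∀ {x y z : D} (m : x ⇸ y) (n : y ⇸ z),
    pro x ◁ₚ G.laxComp m n ≫ comparison (m ⊙ n) =
      (hassoc _ _ _).inv ≫ comparison m ▷ₚ G.mapPro n ≫ (hassoc _ _ _).hom ≫
        F.mapPro m ◁ₚ comparison n ≫ (hassoc _ _ _).inv ≫ F.laxComp m n ▷ₚ pro z
  comparison_hid : ∀ x : D,
    pro x ◁ₚ G.laxId x ≫ comparison (hid x) =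
      (rightUnitor _).hom ≫ (leftUnitor _).inv ≫ F.laxId x ▷ₚ pro x

attribute [simp] LaxProtransf.src_arr LaxProtransf.tgt_arr

/-- A pseudo protransformation `F ⇸ G`: all naturality comparisons are invertible. -/
structure PseudoProtransf (F G : LaxDoubleFunctor D E) extends LaxProtransf F G where
  isIso_comparison : ∀ {x y : D} (m : x ⇸ y), IsIso (comparison m)

attribute [instance] PseudoProtransf.isIso_comparison

/-- A modification (a cell of transformations) with top `σ` and bottom `τ`; its left and right boundary natural
transformations are part of the data. -/
structure Modif {F G H K : LaxDoubleFunctor D E} (σ : LaxProtransf F G)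
    (τ : LaxProtransf H K) where
  left : F ⟶ H
  right : G ⟶ K
  app : ∀ x : D, Cell (σ.pro x) (τ.pro x)
  src_app : ∀ x : D, src (app x) = left.app x
  tgt_app : ∀ x : D, tgt (app x) = right.app x
  arr_equivariance : ∀ {x y : D} (f : x ⟶ y), app x ≫ τ.arr f = σ.arr f ≫ app y
  pro_equivariance : ∀ {x y : D} (m : x ⇸ y),
    hcompMap (app x) (right.cell m) (by rw [tgt_app, right.src_cell]) ≫
        (τ.comparison m).cell =
      (σ.comparison m).cell ≫
        hcompMap (left.cell m) (app y) (by rw [src_app, left.tgt_cell])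

attribute [simp] Modif.src_app Modif.tgt_app

@[ext]
theorem Modif.ext' {F G H K : LaxDoubleFunctor D E} {σ : LaxProtransf F G}
    {τ : LaxProtransf H K} {μ ν : Modif σ τ} (hl : μ.left = ν.left) (hr : μ.right = ν.right)
    (happ : ∀ x, μ.app x = ν.app x) : μ = ν := by
  cases μ; cases ν
  cases hl; cases hr
  congr
  exact funext happ

end

/-! ### The double category of pseudo protransformations -/

section
variable {E : Type u} [DoubleCategory.{t, w, v} E]

/-- Composite of two naturality comparisons. -/
def compCmp {a₀ a₁ b₀ b₁ c₀ c₁ : E} {f : a₀ ⇸ a₁} {g : b₀ ⇸ b₁} {h : c₀ ⇸ c₁}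
    {s₀ : a₀ ⇸ b₀} {s₁ : a₁ ⇸ b₁} {t₀ : b₀ ⇸ c₀} {t₁ : b₁ ⇸ c₁}
    (σ : s₀ ⊙ g ⟶ f ⊙ s₁) (τ : t₀ ⊙ h ⟶ g ⊙ t₁) : s₀ ⊙ t₀ ⊙ h ⟶ f ⊙ (s₁ ⊙ t₁) :=
  (hassoc _ _ _).hom ≫ s₀ ◁ₚ τ ≫ (hassoc _ _ _).inv ≫ σ ▷ₚ t₁ ≫ (hassoc _ _ _).hom

/-- Naturality comparison of the identity protransformation. -/
def idCmp {a₀ a₁ : E} (f : a₀ ⇸ a₁) : hid a₀ ⊙ f ⟶ f ⊙ hid a₁ :=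
  (leftUnitor f).hom ≫ (rightUnitor f).inv

instance isIso_compCmp {a₀ a₁ b₀ b₁ c₀ c₁ : E} {f : a₀ ⇸ a₁} {g : b₀ ⇸ b₁} {h : c₀ ⇸ c₁}
    {s₀ : a₀ ⇸ b₀} {s₁ : a₁ ⇸ b₁} {t₀ : b₀ ⇸ c₀} {t₁ : b₁ ⇸ c₁}
    (σ : s₀ ⊙ g ⟶ f ⊙ s₁) (τ : t₀ ⊙ h ⟶ g ⊙ t₁) [IsIso σ] [IsIso τ] :
    IsIso (compCmp σ τ) := by
  unfold compCmp; infer_instance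

instance isIso_idCmp {a₀ a₁ : E} (f : a₀ ⇸ a₁) : IsIso (idCmp f) := by
  unfold idCmp; infer_instance

theorem hcompMap_sq {x y z x' y' z' x₁ y₁ z₁ x₂ y₂ z₂ : E}
    {m : x ⇸ y} {n : y ⇸ z} {m' : x' ⇸ y'} {n' : y' ⇸ z'}
    {m₁ : x₁ ⇸ y₁} {n₁ : y₁ ⇸ z₁} {m₂ : x₂ ⇸ y₂} {n₂ : y₂ ⇸ z₂}
    {α : Cell m m'} {β : Cell m' m₂} {α' : Cell m m₁} {β' : Cell m₁ m₂}
    {γ : Cell n n'} {δ : Cell n' n₂} {γ' : Cell n n₁} {δ' : Cell n₁ n₂}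
    (h₁ : tgt α = src γ) (h₂ : tgt β = src δ) (h₃ : tgt α' = src γ') (h₄ : tgt β' = src δ')
    (h : α ≫ β = α' ≫ β') (h' : γ ≫ δ = γ' ≫ δ') :
    hcompMap α γ h₁ ≫ hcompMap β δ h₂ = hcompMap α' γ' h₃ ≫ hcompMap β' δ' h₄ := by
  rw [← hcompMap_comp, ← hcompMap_comp]
  exact hcompMap_congr h h'

theorem inv_sq {x y x' y' : E} {m n : x ⇸ y} {m' n' : x' ⇸ y'} (e : m ≅ n) (e' : m' ≅ n')
    {α : Cell m m'} {β : Cell n n'} (h : α ≫ e'.hom.cell = e.hom.cell ≫ β) :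
    e.inv.cell ≫ α = β ≫ e'.inv.cell := by
  have h₁ : e.inv.cell ≫ e.hom.cell = 𝟙 _ := congrArg Glob.cell e.inv_hom_id
  have h₂ : e'.hom.cell ≫ e'.inv.cell = 𝟙 _ := congrArg Glob.cell e'.hom_inv_id
  calc e.inv.cell ≫ α = e.inv.cell ≫ (α ≫ e'.hom.cell) ≫ e'.inv.cell := by
        rw [Category.assoc, h₂, Category.comp_id]
    _ = (e.inv.cell ≫ e.hom.cell) ≫ β ≫ e'.inv.cell := by
        rw [h]; simp only [Category.assoc]
    _ = _ := by rw [h₁, Category.id_comp]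

theorem compCmp_sq {a₀ a₁ b₀ b₁ c₀ c₁ a₀' a₁' b₀' b₁' c₀' c₁' : E}
    {f : a₀ ⇸ a₁} {g : b₀ ⇸ b₁} {h : c₀ ⇸ c₁}
    {s₀ : a₀ ⇸ b₀} {s₁ : a₁ ⇸ b₁} {t₀ : b₀ ⇸ c₀} {t₁ : b₁ ⇸ c₁}
    {f' : a₀' ⇸ a₁'} {g' : b₀' ⇸ b₁'} {h' : c₀' ⇸ c₁'}
    {s₀' : a₀' ⇸ b₀'} {s₁' : a₁' ⇸ b₁'} {t₀' : b₀' ⇸ c₀'} {t₁' : b₁' ⇸ c₁'}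
    (σ : s₀ ⊙ g ⟶ f ⊙ s₁) (τ : t₀ ⊙ h ⟶ g ⊙ t₁)
    (σ' : s₀' ⊙ g' ⟶ f' ⊙ s₁') (τ' : t₀' ⊙ h' ⟶ g' ⊙ t₁')
    (φ : Cell f f') (γ : Cell g g') (χ : Cell h h')
    (α₀ : Cell s₀ s₀') (α₁ : Cell s₁ s₁') (β₀ : Cell t₀ t₀') (β₁ : Cell t₁ t₁')
    (h₁ : tgt α₀ = src γ) (h₂ : tgt φ = src α₁) (h₃ : tgt β₀ = src χ) (h₄ : tgt γ = src β₁)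
    (h₅ : tgt α₀ = src β₀) (h₆ : tgt α₁ = src β₁)
    (hσ : hcompMap α₀ γ h₁ ≫ σ'.cell = σ.cell ≫ hcompMap φ α₁ h₂)
    (hτ : hcompMap β₀ χ h₃ ≫ τ'.cell = τ.cell ≫ hcompMap γ β₁ h₄) :
    hcompMap (hcompMap α₀ β₀ h₅) χ ((tgt_hcompMap _ _ _).trans h₃) ≫ (compCmp σ' τ').cell =
      (compCmp σ τ).cell ≫
        hcompMap φ (hcompMap α₁ β₁ h₆) (h₂.trans (src_hcompMap _ _ _).symm) := by
  have q₁ := hassoc_naturality α₀ β₀ χ h₅ h₃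
  have q₂ : hcompMap α₀ (hcompMap β₀ χ h₃) (h₅.trans (src_hcompMap _ _ _).symm) ≫
      (s₀' ◁ₚ τ').cell = (s₀ ◁ₚ τ).cell ≫
        hcompMap α₀ (hcompMap γ β₁ h₄) (h₁.trans (src_hcompMap _ _ _).symm) :=
    hcompMap_sq _ _ _ _ (by rw [Category.comp_id, Category.id_comp]) hτ
  have q₃ := inv_sq _ _ (hassoc_naturality α₀ γ β₁ h₁ h₄)
  have q₄ : hcompMap (hcompMap α₀ γ h₁) β₁ ((tgt_hcompMap _ _ _).trans h₄) ≫
      (σ' ▷ₚ t₁').cell = (σ ▷ₚ t₁).cell ≫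
        hcompMap (hcompMap φ α₁ h₂) β₁ ((tgt_hcompMap _ _ _).trans h₆) :=
    hcompMap_sq _ _ _ _ hσ (by rw [Category.comp_id, Category.id_comp])
  have q₅ := hassoc_naturality φ α₁ β₁ h₂ h₆
  have r₁ : CommSq _ _ _ _ := ⟨q₁.symm⟩
  have r₂ : CommSq _ _ _ _ := ⟨q₂.symm⟩
  have r₃ : CommSq _ _ _ _ := ⟨q₃⟩
  have r₄ : CommSq _ _ _ _ := ⟨q₄.symm⟩
  have r₅ : CommSq _ _ _ _ := ⟨q₅.symm⟩
  exact (r₁.horiz_comp (r₂.horiz_comp (r₃.horiz_comp (r₄.horiz_comp r₅)))).w.symm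

theorem idCmp_sq {x y x' y' : E} {m : x ⇸ y} {n : x' ⇸ y'} (α : Cell m n) {f : x ⟶ x'}
    {g : y ⟶ y'} (hf : src α = f) (hg : tgt α = g) :
    hcompMap (hidMap f) α ((tgt_hidMap f).trans hf.symm) ≫ (idCmp n).cell =
      (idCmp m).cell ≫ hcompMap α (hidMap g) (hg.trans (src_hidMap g).symm) := by
  subst hf hg
  have r₁ : CommSq _ _ _ _ := ⟨(leftUnitor_naturality α).symm⟩
  have r₂ : CommSq _ _ _ _ := ⟨inv_sq _ _ (rightUnitor_naturality α)⟩
  exact (r₁.horiz_comp r₂).w.symm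

end

section
open Bicategory
variable {B : Type u} [Bicategory.{w, v} B]

/-- Composite of two comparisons, in a bicategory. -/
abbrev bicatCmp {a₀ a₁ b₀ b₁ c₀ c₁ : B} {f : a₀ ⟶ a₁} {g : b₀ ⟶ b₁} {h : c₀ ⟶ c₁}
    {s₀ : a₀ ⟶ b₀} {s₁ : a₁ ⟶ b₁} {t₀ : b₀ ⟶ c₀} {t₁ : b₁ ⟶ c₁}
    (σ : s₀ ≫ g ⟶ f ≫ s₁) (τ : t₀ ≫ h ⟶ g ≫ t₁) : (s₀ ≫ t₀) ≫ h ⟶ f ≫ (s₁ ≫ t₁) :=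
  (α_ _ _ _).hom ≫ s₀ ◁ τ ≫ (α_ _ _ _).inv ≫ σ ▷ t₁ ≫ (α_ _ _ _).hom

theorem bicat_hcomp {a₀ a₁ a₂ b₀ b₁ b₂ c₀ c₁ c₂ : B}
    {f : a₀ ⟶ a₁} {g : b₀ ⟶ b₁} {h : c₀ ⟶ c₁} {f' : a₁ ⟶ a₂} {g' : b₁ ⟶ b₂} {h' : c₁ ⟶ c₂}
    {f'' : a₀ ⟶ a₂} {g'' : b₀ ⟶ b₂} {h'' : c₀ ⟶ c₂}
    {s₀ : a₀ ⟶ b₀} {s₁ : a₁ ⟶ b₁} {s₂ : a₂ ⟶ b₂}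
    {t₀ : b₀ ⟶ c₀} {t₁ : b₁ ⟶ c₁} {t₂ : b₂ ⟶ c₂}
    (F : f ≫ f' ⟶ f'') (G : g ≫ g' ⟶ g'') (H : h ≫ h' ⟶ h'')
    (σ : s₀ ≫ g ⟶ f ≫ s₁) (σ' : s₁ ≫ g' ⟶ f' ≫ s₂) (σ'' : s₀ ≫ g'' ⟶ f'' ≫ s₂)
    (τ : t₀ ≫ h ⟶ g ≫ t₁) (τ' : t₁ ≫ h' ⟶ g' ≫ t₂) (τ'' : t₀ ≫ h'' ⟶ g'' ≫ t₂)
    (hσ : s₀ ◁ G ≫ σ'' =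
      (α_ _ _ _).inv ≫ σ ▷ g' ≫ (α_ _ _ _).hom ≫ f ◁ σ' ≫ (α_ _ _ _).inv ≫ F ▷ s₂)
    (hτ : t₀ ◁ H ≫ τ'' =
      (α_ _ _ _).inv ≫ τ ▷ h' ≫ (α_ _ _ _).hom ≫ g ◁ τ' ≫ (α_ _ _ _).inv ≫ G ▷ t₂) :
    (s₀ ≫ t₀) ◁ H ≫ bicatCmp σ'' τ'' =
      (α_ _ _ _).inv ≫ bicatCmp σ τ ▷ h' ≫ (α_ _ _ _).hom ≫ f ◁ bicatCmp σ' τ' ≫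
        (α_ _ _ _).inv ≫ F ▷ (s₂ ≫ t₂) :=
  calc
    _ = 𝟙 _ ⊗≫ s₀ ◁ (t₀ ◁ H ≫ τ'') ⊗≫ σ'' ▷ t₂ ⊗≫ 𝟙 _ := by
      bicategory
    _ = 𝟙 _ ⊗≫ s₀ ◁ (τ ▷ h' ⊗≫ g ◁ τ') ⊗≫ (s₀ ◁ G ≫ σ'') ▷ t₂ ⊗≫ 𝟙 _ := by
      rw [hτ]
      bicategory
    _ = 𝟙 _ ⊗≫ s₀ ◁ τ ▷ h' ⊗≫ ((s₀ ≫ g) ◁ τ' ≫ σ ▷ (g' ≫ t₂)) ⊗≫ f ◁ σ' ▷ t₂ ⊗≫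
          F ▷ s₂ ▷ t₂ ⊗≫ 𝟙 _ := by
      rw [hσ]
      bicategory
    _ = _ := by
      rw [Bicategory.whisker_exchange]
      bicategory

theorem bicat_hid {a b c : B} {f : a ⟶ a} {g : b ⟶ b} {h : c ⟶ c} {s : a ⟶ b} {t : b ⟶ c}
    (F : 𝟙 a ⟶ f) (G : 𝟙 b ⟶ g) (H : 𝟙 c ⟶ h) (σ : s ≫ g ⟶ f ≫ s) (τ : t ≫ h ⟶ g ≫ t)
    (hσ : s ◁ G ≫ σ = (ρ_ s).hom ≫ (λ_ s).inv ≫ F ▷ s)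
    (hτ : t ◁ H ≫ τ = (ρ_ t).hom ≫ (λ_ t).inv ≫ G ▷ t) :
    (s ≫ t) ◁ H ≫ bicatCmp σ τ =
      (ρ_ (s ≫ t)).hom ≫ (λ_ (s ≫ t)).inv ≫ F ▷ (s ≫ t) :=
  calc
    _ = 𝟙 _ ⊗≫ s ◁ (t ◁ H ≫ τ) ⊗≫ σ ▷ t ⊗≫ 𝟙 _ := by
      bicategory
    _ = 𝟙 _ ⊗≫ (s ◁ G ≫ σ) ▷ t ⊗≫ 𝟙 _ := by
      rw [hτ]
      bicategory
    _ = _ := by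
      rw [hσ]
      bicategory

theorem bicat_id_hcomp {a₀ a₁ a₂ : B} {f : a₀ ⟶ a₁} {f' : a₁ ⟶ a₂} {f'' : a₀ ⟶ a₂}
    (F : f ≫ f' ⟶ f'') :
    𝟙 a₀ ◁ F ≫ (λ_ f'').hom ≫ (ρ_ f'').inv =
      (α_ _ _ _).inv ≫ ((λ_ f).hom ≫ (ρ_ f).inv) ▷ f' ≫ (α_ _ _ _).hom ≫
        f ◁ ((λ_ f').hom ≫ (ρ_ f').inv) ≫ (α_ _ _ _).inv ≫ F ▷ 𝟙 a₂ := by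
  bicategory

theorem bicat_id_hid {a : B} {f : a ⟶ a} (F : 𝟙 a ⟶ f) :
    𝟙 a ◁ F ≫ (λ_ f).hom ≫ (ρ_ f).inv =
      (ρ_ (𝟙 a)).hom ≫ (λ_ (𝟙 a)).inv ≫ F ▷ 𝟙 a := by
  bicategory

theorem bicat_assoc {a₀ a₁ b₀ b₁ c₀ c₁ d₀ d₁ : B}
    {f : a₀ ⟶ a₁} {g : b₀ ⟶ b₁} {h : c₀ ⟶ c₁} {k : d₀ ⟶ d₁}
    {s₀ : a₀ ⟶ b₀} {s₁ : a₁ ⟶ b₁} {t₀ : b₀ ⟶ c₀} {t₁ : b₁ ⟶ c₁} {r₀ : c₀ ⟶ d₀} {r₁ : c₁ ⟶ d₁}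
    (σ : s₀ ≫ g ⟶ f ≫ s₁) (τ : t₀ ≫ h ⟶ g ≫ t₁) (ρ : r₀ ≫ k ⟶ h ≫ r₁) :
    (α_ s₀ t₀ r₀).hom ▷ k ≫ bicatCmp σ (bicatCmp τ ρ) =
      bicatCmp (bicatCmp σ τ) ρ ≫ f ◁ (α_ s₁ t₁ r₁).hom := by
  bicategory

theorem bicat_leftUnitor {a₀ a₁ b₀ b₁ : B} {f : a₀ ⟶ a₁} {g : b₀ ⟶ b₁}
    {s₀ : a₀ ⟶ b₀} {s₁ : a₁ ⟶ b₁} (σ : s₀ ≫ g ⟶ f ≫ s₁) :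
    (λ_ s₀).hom ▷ g ≫ σ = bicatCmp ((λ_ f).hom ≫ (ρ_ f).inv) σ ≫ f ◁ (λ_ s₁).hom := by
  bicategory

theorem bicat_rightUnitor {a₀ a₁ b₀ b₁ : B} {f : a₀ ⟶ a₁} {g : b₀ ⟶ b₁}
    {s₀ : a₀ ⟶ b₀} {s₁ : a₁ ⟶ b₁} (σ : s₀ ≫ g ⟶ f ≫ s₁) :
    (ρ_ s₀).hom ▷ g ≫ σ = bicatCmp σ ((λ_ g).hom ≫ (ρ_ g).inv) ≫ f ◁ (ρ_ s₁).hom := by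
  bicategory

end

section
variable {D : Type u₁} [DoubleCategory.{t₁, w₁, v₁} D]
variable {E : Type u₂} [DoubleCategory.{t₂, w₂, v₂} E]

/-- External composition of lax protransformations. -/
def LaxProtransf.comp {F G H : LaxDoubleFunctor D E} (σ : LaxProtransf F G)
    (τ : LaxProtransf G H) : LaxProtransf F H where
  pro x := σ.pro x ⊙ τ.pro x
  arr f := hcompMap (σ.arr f) (τ.arr f) (by simp)
  src_arr f := by simp
  tgt_arr f := by simp
  comparison m := compCmp (σ.comparison m) (τ.comparison m)
  arr_id x := (hcompMap_congr (σ.arr_id x) (τ.arr_id x)).trans (hcompMap_id _ _)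
  arr_comp f g := (hcompMap_congr (σ.arr_comp f g) (τ.arr_comp f g)).trans
    (hcompMap_comp _ _ _ _ _ _)
  naturality γ := (compCmp_sq _ _ _ _ _ (G.mapCell γ) _ _ _ _ _ (by simp) (by simp) (by simp)
    (by simp) (by simp) (by simp) (σ.naturality γ).symm (τ.naturality γ).symm).symm
  comparison_hcomp m n := bicat_hcomp (B := UBicat E) _ _ _ _ _ _ _ _ _
    (σ.comparison_hcomp m n) (τ.comparison_hcomp m n)
  comparison_hid x := bicat_hid (B := UBicat E) _ _ _ _ _
    (σ.comparison_hid x) (τ.comparison_hid x)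

/-- The identity protransformation. -/
def LaxProtransf.id (F : LaxDoubleFunctor D E) : LaxProtransf F F where
  pro x := hid (F.obj x)
  arr f := hidMap (F.map f)
  src_arr f := by simp
  tgt_arr f := by simp
  comparison m := idCmp (F.mapPro m)
  arr_id x := by rw [F.map_id, hidMap_id]
  arr_comp f g := by rw [F.map_comp, hidMap_comp]
  naturality γ := (idCmp_sq _ (by simp) (by simp)).symm
  comparison_hcomp m n := bicat_id_hcomp (B := UBicat E) _
  comparison_hid x := bicat_id_hid (B := UBicat E) _

def PseudoProtransf.comp {F G H : LaxDoubleFunctor D E} (σ : PseudoProtransf F G)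
    (τ : PseudoProtransf G H) : PseudoProtransf F H where
  toLaxProtransf := σ.toLaxProtransf.comp τ.toLaxProtransf
  isIso_comparison m := isIso_compCmp (σ.comparison m) (τ.comparison m)

def PseudoProtransf.id (F : LaxDoubleFunctor D E) : PseudoProtransf F F where
  toLaxProtransf := LaxProtransf.id F
  isIso_comparison m := isIso_idCmp (F.mapPro m)

/-- Internal (vertical) identities and composition of modifications. -/
def Modif.id {F G : LaxDoubleFunctor D E} (σ : LaxProtransf F G) : Modif σ σ where
  left := 𝟙 F
  right := 𝟙 G
  app x := 𝟙 (Loose.mk (σ.pro x))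
  src_app x := src_id _
  tgt_app x := tgt_id _
  arr_equivariance f := by rw [Category.id_comp, Category.comp_id]
  pro_equivariance m := by
    refine (congrArg (· ≫ _) (hcompMap_id _ _)).trans (Eq.trans ?_
      (congrArg (_ ≫ ·) (hcompMap_id _ _).symm))
    rw [Category.id_comp, Category.comp_id]

def Modif.comp {F G F' G' F'' G'' : LaxDoubleFunctor D E} {σ : LaxProtransf F G}
    {τ : LaxProtransf F' G'} {ρ : LaxProtransf F'' G''} (μ : Modif σ τ) (ν : Modif τ ρ) :
    Modif σ ρ where
  left := μ.left ≫ ν.left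
  right := μ.right ≫ ν.right
  app x := μ.app x ≫ ν.app x
  src_app x := by rw [src_comp, μ.src_app, ν.src_app]; rfl
  tgt_app x := by rw [tgt_comp, μ.tgt_app, ν.tgt_app]; rfl
  arr_equivariance f := by
    rw [Category.assoc, ν.arr_equivariance, ← Category.assoc, μ.arr_equivariance,
      Category.assoc]
  pro_equivariance m := by
    refine (congrArg (· ≫ _) (hcompMap_comp _ _ _ _ (by simp) (by simp))).trans (Eq.trans ?_
      (congrArg (_ ≫ ·) (hcompMap_comp _ _ _ _ (by simp) (by simp)).symm))
    rw [Category.assoc, ν.pro_equivariance, ← Category.assoc, μ.pro_equivariance,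
      Category.assoc]

/-- External composition of modifications. -/
def Modif.hcomp {F G H F' G' H' : LaxDoubleFunctor D E} {σ : LaxProtransf F G}
    {τ : LaxProtransf G H} {σ' : LaxProtransf F' G'} {τ' : LaxProtransf G' H'}
    (μ : Modif σ σ') (ν : Modif τ τ') (h : μ.right = ν.left) :
    Modif (σ.comp τ) (σ'.comp τ') where
  left := μ.left
  right := ν.right
  app x := hcompMap (μ.app x) (ν.app x) (by simp [h])
  src_app x := (src_hcompMap _ _ _).trans (μ.src_app x)
  tgt_app x := (tgt_hcompMap _ _ _).trans (ν.tgt_app x)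
  arr_equivariance f := hcompMap_sq _ _ _ _ (μ.arr_equivariance f) (ν.arr_equivariance f)
  pro_equivariance m := compCmp_sq _ _ _ _ _ (μ.right.cell m) _ _ _ _ _ (by simp) (by simp)
    (by simp) (by simp [h]) (by simp [h]) (by simp [h]) (μ.pro_equivariance m)
    (by simpa [h] using ν.pro_equivariance m)

/-- The external identity modification on a natural transformation. -/
def Modif.hid {F G : LaxDoubleFunctor D E} (α : F ⟶ G) :
    Modif (LaxProtransf.id F) (LaxProtransf.id G) where
  left := α
  right := α
  app x := hidMap (α.app x)
  src_app x := src_hidMap _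
  tgt_app x := tgt_hidMap _
  arr_equivariance f := by
    refine (hidMap_comp _ _).symm.trans (Eq.trans ?_ (hidMap_comp _ _))
    rw [α.naturality]
  pro_equivariance m := idCmp_sq _ (by simp) (by simp)

/-- Modifications with identity boundaries, from globular components. -/
def Modif.ofGlob {F G : LaxDoubleFunctor D E} {σ τ : LaxProtransf F G}
    (e : ∀ x, σ.pro x ⟶ τ.pro x)
    (h : ∀ {x y : D} (f : x ⟶ y), (e x).cell ≫ τ.arr f = σ.arr f ≫ (e y).cell)
    (h' : ∀ {x y : D} (m : x ⇸ y),
      e x ▷ₚ G.mapPro m ≫ τ.comparison m = σ.comparison m ≫ F.mapPro m ◁ₚ e y) :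
    Modif σ τ where
  left := 𝟙 F
  right := 𝟙 G
  app x := (e x).cell
  src_app x := (e x).src_cell
  tgt_app x := (e x).tgt_cell
  arr_equivariance f := h f
  pro_equivariance m := congrArg Glob.cell (h' m)

end

/-- The double category `LaxPs(D, E)`: its objects are the lax double functors `D → E`. -/
def LaxPs (D : Type u₁) [DoubleCategory.{t₁, w₁, v₁} D] (E : Type u₂)
    [DoubleCategory.{t₂, w₂, v₂} E] := LaxDoubleFunctor D E

section
variable {D : Type u₁} [DoubleCategory.{t₁, w₁, v₁} D]
variable {E : Type u₂} [DoubleCategory.{t₂, w₂, v₂} E]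

/-- Arrows are natural transformations, proarrows are pseudo protransformations, and cells are
modifications. -/
instance : PreDoubleCategory.{max u₁ w₁ v₂ t₂, max u₁ v₁ w₁ w₂ t₂, max u₁ w₁ v₂ t₂}
    (LaxPs D E) where
  toCategory := inferInstanceAs (Category (LaxDoubleFunctor D E))
  Pro F G := PseudoProtransf (D := D) (E := E) F G
  cellCategory :=
    { Hom := fun P Q => Modif P.pro.toLaxProtransf Q.pro.toLaxProtransf
      id := fun P => Modif.id P.pro.toLaxProtransf
      comp := fun μ ν => Modif.comp μ ν
      id_comp := fun _ => Modif.ext' (Category.id_comp _) (Category.id_comp _)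
        (fun _ => Category.id_comp _)
      comp_id := fun _ => Modif.ext' (Category.comp_id _) (Category.comp_id _)
        (fun _ => Category.comp_id _)
      assoc := fun _ _ _ => Modif.ext' (Category.assoc _ _ _) (Category.assoc _ _ _)
        (fun _ => Category.assoc _ _ _) }
  src μ := Modif.left μ
  tgt μ := Modif.right μ
  src_id _ := rfl
  tgt_id _ := rfl
  src_comp _ _ := rfl
  tgt_comp _ _ := rfl

/-- The pseudo protransformation underlying a proarrow of `LaxPs D E`. -/
abbrev LaxPs.toProtransf {F G : LaxPs D E} (σ : F ⇸ G) :
    PseudoProtransf (D := D) (E := E) F G := σ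

/-- Globular isomorphisms in `LaxPs D E`, from globular isomorphisms of components. -/
def LaxPs.mkIso {F G : LaxPs D E} {σ τ : F ⇸ G}
    (e : ∀ x, (toProtransf σ).pro x ≅ (toProtransf τ).pro x)
    (h : ∀ {x y : D} (f : x ⟶ y),
      (e x).hom.cell ≫ (toProtransf τ).arr f = (toProtransf σ).arr f ≫ (e y).hom.cell)
    (h' : ∀ {x y : D} (m : x ⇸ y),
      (e x).hom ▷ₚ LaxDoubleFunctor.mapPro G m ≫ (toProtransf τ).comparison m =
        (toProtransf σ).comparison m ≫ LaxDoubleFunctor.mapPro F m ◁ₚ (e y).hom) :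
    σ ≅ τ where
  hom := ⟨Modif.ofGlob (fun x => (e x).hom) h h', rfl, rfl⟩
  inv := ⟨Modif.ofGlob (fun x => (e x).inv) (fun f => inv_sq _ _ (h f).symm) (fun {x y} m => by
      have h₁ : (e x).inv ▷ₚ LaxDoubleFunctor.mapPro G m ≫ (e x).hom ▷ₚ LaxDoubleFunctor.mapPro G m = 𝟙 _ := by
        rw [← comp_whiskerR, Iso.inv_hom_id, id_whiskerR]
      have h₂ : LaxDoubleFunctor.mapPro F m ◁ₚ (e y).hom ≫ LaxDoubleFunctor.mapPro F m ◁ₚ (e y).inv = 𝟙 _ := by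
        rw [← whiskerL_comp, Iso.hom_inv_id, whiskerL_id]
      calc (e x).inv ▷ₚ LaxDoubleFunctor.mapPro G m ≫ (toProtransf σ).comparison m
          = (e x).inv ▷ₚ LaxDoubleFunctor.mapPro G m ≫ ((toProtransf σ).comparison m ≫ LaxDoubleFunctor.mapPro F m ◁ₚ (e y).hom) ≫
              LaxDoubleFunctor.mapPro F m ◁ₚ (e y).inv := by
            rw [Category.assoc, h₂, Category.comp_id]
        _ = ((e x).inv ▷ₚ LaxDoubleFunctor.mapPro G m ≫ (e x).hom ▷ₚ LaxDoubleFunctor.mapPro G m) ≫ (toProtransf τ).comparison m ≫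
              LaxDoubleFunctor.mapPro F m ◁ₚ (e y).inv := by
            rw [← h']; simp only [Category.assoc]
        _ = _ := by rw [h₁, Category.id_comp]), rfl, rfl⟩
  hom_inv_id := Glob.ext (Modif.ext' (Category.id_comp _) (Category.id_comp _)
    (fun x => congrArg Glob.cell (e x).hom_inv_id))
  inv_hom_id := Glob.ext (Modif.ext' (Category.id_comp _) (Category.id_comp _)
    (fun x => congrArg Glob.cell (e x).inv_hom_id))

instance : DoubleCategory.{max u₁ w₁ v₂ t₂, max u₁ v₁ w₁ w₂ t₂, max u₁ w₁ v₂ t₂}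
    (LaxPs D E) where
  hid F := PseudoProtransf.id F
  hidMap α := Modif.hid α
  src_hidMap _ := rfl
  tgt_hidMap _ := rfl
  hidMap_id F := Modif.ext' rfl rfl (fun x => hidMap_id _)
  hidMap_comp α β := Modif.ext' rfl rfl (fun x => hidMap_comp _ _)
  hcomp σ τ := PseudoProtransf.comp σ τ
  hcompMap μ ν h := Modif.hcomp μ ν h
  src_hcompMap _ _ _ := rfl
  tgt_hcompMap _ _ _ := rfl
  hcompMap_id σ τ := Modif.ext' rfl rfl (fun x => hcompMap_id _ _)
  hcompMap_comp μ ν μ' ν' h h' := Modif.ext' rfl rfl (fun x => hcompMap_comp _ _ _ _ _ _)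
  hassoc σ τ ρ := LaxPs.mkIso (σ := PseudoProtransf.comp (PseudoProtransf.comp σ τ) ρ)
    (τ := PseudoProtransf.comp σ (PseudoProtransf.comp τ ρ)) (fun x => hassoc _ _ _)
    (fun f => (hassoc_naturality _ _ _ _ _).symm)
    (fun m => bicat_assoc (B := UBicat E) _ _ _)
  hassoc_naturality μ ν κ h h' := Modif.ext'
    ((Category.comp_id _).trans (Category.id_comp _).symm)
    ((Category.comp_id _).trans (Category.id_comp _).symm)
    (fun x => hassoc_naturality _ _ _ _ _)
  leftUnitor {F _} σ := LaxPs.mkIso (σ := PseudoProtransf.comp (PseudoProtransf.id F) σ)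
    (τ := σ) (fun x => leftUnitor _)
    (fun f => by
      refine (leftUnitor_naturality _).symm.trans (congrArg (· ≫ _) ?_)
      exact hcompMap_congr (congrArg hidMap (LaxProtransf.src_arr _ f)) rfl)
    (fun m => bicat_leftUnitor (B := UBicat E) _)
  leftUnitor_naturality μ := Modif.ext'
    ((Category.comp_id _).trans (Category.id_comp _).symm)
    ((Category.comp_id _).trans (Category.id_comp _).symm)
    (fun x => by
      refine Eq.trans (congrArg (· ≫ _) ?_) (leftUnitor_naturality (Modif.app μ x))
      exact hcompMap_congr (congrArg hidMap (Modif.src_app μ x).symm) rfl)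
  rightUnitor {_ G} σ := LaxPs.mkIso (σ := PseudoProtransf.comp σ (PseudoProtransf.id G))
    (τ := σ) (fun x => rightUnitor _)
    (fun f => by
      refine (rightUnitor_naturality _).symm.trans (congrArg (· ≫ _) ?_)
      exact hcompMap_congr rfl (congrArg hidMap (LaxProtransf.tgt_arr _ f)))
    (fun m => bicat_rightUnitor (B := UBicat E) _)
  rightUnitor_naturality μ := Modif.ext'
    ((Category.comp_id _).trans (Category.id_comp _).symm)
    ((Category.comp_id _).trans (Category.id_comp _).symm)
    (fun x => by
      refine Eq.trans (congrArg (· ≫ _) ?_) (rightUnitor_naturality (Modif.app μ x))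
      exact hcompMap_congr rfl (congrArg hidMap (Modif.tgt_app μ x).symm))
  pentagon σ τ ρ κ := Modif.ext' (Category.id_comp _) (Category.id_comp _) (fun x => pentagon _ _ _ _)
  triangle σ τ := Modif.ext' (Category.id_comp _) (Category.id_comp _) (fun x => triangle _ _)

end
end DoubleCat

open DoubleCat

/-! A companion of an arrow `f` is the same thing as universal cells. Its counit gives a cartesian
cell `f_! ⊙ n ⟶ n` (`restr`), its unit an opcartesian cell `m ⟶ m ⊙ f_!` (`extr`). The internal law
`η ⬝ ε = id_f` makes factorizations through them exist (`lift`, `desc`), and the external law `η ⊙ ε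
= 1` makes them unique (`restr_ext`, `extr_ext`). Hence `θ_!` is the globular cell characterized by
`extr ≫ θ_! = lift θ`, and equally by `θ_! ≫ restr = desc θ`. A globular cell `T` is therefore
inverse to `θ_!` precisely when `lift θ ≫ T = extr` and `T ≫ desc θ = restr`.

For `θ = α_m` these two equations are, up to unitors, the equivariance conditions at `m` for
modifications with components `η_x` and `ε_x` into and out of a protransformation whose comparison
at `m` is `T`. So a companion of `α` yields companions of all `α_x`, and its comparisons are inverse
to the cells `(α_m)_!`. Conversely, if every `(α_m)_!` is invertible, the inverses serve as
comparisons. Their naturality and coherence come from inverting `slideCompanion_naturality`,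
`slideCompanion_hcomp` and `slideCompanion_hid`, which translate the axioms of `α` by testing on
opcartesian cells. The components at arrows are the canonical cells `map`, functorial because a cell
out of `f_!` is determined by its restriction along `η` and its right boundary (`unit_ext`).
Independence of the chosen companions is `isIso_slideCompanion_of_isIso`.

Conjoints are the left-right mirror image, with one difference. A conjoint `α^*` runs from `G` to
`F`, so `(α_m)^*` already points in the direction of a comparison: the comparison is `(α_m)^*`
itself and nothing has to be inverted. -/

namespace DoubleCat
open PreDoubleCategory DoubleCategory

/-! ### Unitors and associators at the level of cells -/

section Cells
variable {D : Type u} [DoubleCategory.{t, w, v} D]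

theorem iso_hom_inv_cell {x y : D} {m n : x ⇸ y} (e : m ≅ n) :
    e.hom.cell ≫ e.inv.cell = 𝟙 (Loose.mk m) := congrArg Glob.cell e.hom_inv_id

theorem iso_inv_hom_cell {x y : D} {m n : x ⇸ y} (e : m ≅ n) :
    e.inv.cell ≫ e.hom.cell = 𝟙 (Loose.mk n) := congrArg Glob.cell e.inv_hom_id

theorem iso_hom_inv_cell_assoc {x y : D} {m n : x ⇸ y} (e : m ≅ n) {P : Loose (D := D) Pro}
    (φ : Loose.mk m ⟶ P) : e.hom.cell ≫ e.inv.cell ≫ φ = φ := by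
  rw [← Category.assoc, iso_hom_inv_cell, Category.id_comp]

theorem iso_inv_hom_cell_assoc {x y : D} {m n : x ⇸ y} (e : m ≅ n) {P : Loose (D := D) Pro}
    (φ : Loose.mk n ⟶ P) : e.inv.cell ≫ e.hom.cell ≫ φ = φ := by
  rw [← Category.assoc, iso_inv_hom_cell, Category.id_comp]

theorem hcompMap_comp_assoc {x y z x' y' z' x'' y'' z'' : D} {m : x ⇸ y} {n : y ⇸ z}
    {m' : x' ⇸ y'} {n' : y' ⇸ z'} {m'' : x'' ⇸ y''} {n'' : y'' ⇸ z''}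
    (α : Cell m m') (β : Cell n n') (α' : Cell m' m'') (β' : Cell n' n'')
    (h : tgt α = src β) (h' : tgt α' = src β') {P : Loose (D := D) Pro}
    (φ : Loose.mk (m'' ⊙ n'') ⟶ P) :
    hcompMap α β h ≫ hcompMap α' β' h' ≫ φ =
      hcompMap (α ≫ α') (β ≫ β') (frame_comp α β α' β' h h') ≫ φ := by
  rw [hcompMap_comp α β α' β' h h', Category.assoc]

theorem leftUnitor_inv_naturality {x y x' y' : D} {m : x ⇸ y} {n : x' ⇸ y'} (φ : Cell m n)
    {u : x ⟶ x'} (h : src φ = u) :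
    (leftUnitor m).inv.cell ≫ hcompMap (hidMap u) φ ((tgt_hidMap u).trans h.symm) =
      φ ≫ (leftUnitor n).inv.cell := by
  subst h
  exact inv_sq _ _ (leftUnitor_naturality φ)

theorem rightUnitor_inv_naturality {x y x' y' : D} {m : x ⇸ y} {n : x' ⇸ y'} (φ : Cell m n)
    {v : y ⟶ y'} (h : tgt φ = v) :
    (rightUnitor m).inv.cell ≫ hcompMap φ (hidMap v) (h.trans (src_hidMap v).symm) =
      φ ≫ (rightUnitor n).inv.cell := by
  subst h
  exact inv_sq _ _ (rightUnitor_naturality φ)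

/-- This finishes every use of the internal law: once `η ⬝ ε` has become `hidMap f`, the external
composite with it collapses to the other factor. -/
theorem leftUnitor_conj {x y x' y' : D} {m : x ⇸ y} {n : x' ⇸ y'} (φ : Cell m n)
    {u : x ⟶ x'} (h : src φ = u) :
    (leftUnitor m).inv.cell ≫ hcompMap (hidMap u) φ ((tgt_hidMap u).trans h.symm) ≫
      (leftUnitor n).hom.cell = φ := by
  rw [← Category.assoc, leftUnitor_inv_naturality φ h, Category.assoc, iso_inv_hom_cell,
    Category.comp_id]

theorem rightUnitor_conj {x y x' y' : D} {m : x ⇸ y} {n : x' ⇸ y'} (φ : Cell m n)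
    {v : y ⟶ y'} (h : tgt φ = v) :
    (rightUnitor m).inv.cell ≫ hcompMap φ (hidMap v) (h.trans (src_hidMap v).symm) ≫
      (rightUnitor n).hom.cell = φ := by
  rw [← Category.assoc, rightUnitor_inv_naturality φ h, Category.assoc, iso_inv_hom_cell,
    Category.comp_id]

theorem leftUnitor_naturality' {x y x' y' : D} {m : x ⇸ y} {n : x' ⇸ y'} (φ : Cell m n)
    {u : x ⟶ x'} (h : src φ = u) :
    hcompMap (hidMap u) φ ((tgt_hidMap u).trans h.symm) ≫ (leftUnitor n).hom.cell =
      (leftUnitor m).hom.cell ≫ φ := by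
  subst h; exact leftUnitor_naturality φ

theorem rightUnitor_naturality' {x y x' y' : D} {m : x ⇸ y} {n : x' ⇸ y'} (φ : Cell m n)
    {v : y ⟶ y'} (h : tgt φ = v) :
    hcompMap φ (hidMap v) (h.trans (src_hidMap v).symm) ≫ (rightUnitor n).hom.cell =
      (rightUnitor m).hom.cell ≫ φ := by
  subst h; exact rightUnitor_naturality φ

theorem hassoc_inv_naturality {x y z s x' y' z' s' : D} {m : x ⇸ y} {n : y ⇸ z} {p : z ⇸ s}
    {m' : x' ⇸ y'} {n' : y' ⇸ z'} {p' : z' ⇸ s'}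
    (α : Cell m m') (β : Cell n n') (γ : Cell p p') (h : tgt α = src β) (h' : tgt β = src γ) :
    (hassoc m n p).inv.cell ≫ hcompMap (hcompMap α β h) γ ((tgt_hcompMap α β h).trans h') =
      hcompMap α (hcompMap β γ h') (h.trans (src_hcompMap β γ h').symm) ≫
        (hassoc m' n' p').inv.cell :=
  inv_sq _ _ (hassoc_naturality α β γ h h')

/-- Bicategorical coherence, borrowed through `UBicat`. Units start and counits end at an external
identity, where a left unitor coming from one factor must be absorbed as a right unitor by the
other, or conversely. -/
theorem unitors_hid (x : D) : leftUnitor (hid x) = rightUnitor (hid x) :=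
  Iso.ext (Bicategory.unitors_equal (B := UBicat D) (a := x))

/-- A consequence of pentagon and triangle, taken from the underlying bicategory. It moves a unitor
from a composite to a single factor, where a companion or conjoint law can then be applied. -/
theorem rightUnitor_hcomp {x y z : D} (m : x ⇸ y) (n : y ⇸ z) :
    (rightUnitor (m ⊙ n)).inv ≫ (hassoc m n (hid z)).hom = m ◁ₚ (rightUnitor n).inv := by
  have h := Bicategory.rightUnitor_comp_inv (B := UBicat D) (a := x) (b := y) (c := z) m n
  refine (congrArg (· ≫ (hassoc m n (hid z)).hom) h).trans ?_
  refine (Category.assoc _ _ _).trans ?_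
  refine (congrArg (_ ≫ ·) (Iso.inv_hom_id _)).trans (Category.comp_id _)

theorem leftUnitor_hcomp {x y z : D} (m : x ⇸ y) (n : y ⇸ z) :
    (leftUnitor (m ⊙ n)).inv ≫ (hassoc (hid x) m n).inv = (leftUnitor m).inv ▷ₚ n := by
  have h := Bicategory.leftUnitor_comp_inv (B := UBicat D) (a := x) (b := y) (c := z) m n
  refine (congrArg (· ≫ (hassoc (hid x) m n).inv) h).trans ?_
  refine (Category.assoc _ _ _).trans ?_
  refine (congrArg (_ ≫ ·) (Iso.hom_inv_id _)).trans (Category.comp_id _)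

theorem rightUnitor_hcomp_cell {x y z : D} (m : x ⇸ y) (n : y ⇸ z) :
    (rightUnitor (m ⊙ n)).inv.cell ≫ (hassoc m n (hid z)).hom.cell =
      hcompMap (𝟙 (Loose.mk m)) (rightUnitor n).inv.cell (frame_id_glob m _) :=
  congrArg Glob.cell (rightUnitor_hcomp m n)

theorem leftUnitor_hcomp_cell {x y z : D} (m : x ⇸ y) (n : y ⇸ z) :
    (leftUnitor (m ⊙ n)).inv.cell ≫ (hassoc (hid x) m n).inv.cell =
      hcompMap (leftUnitor m).inv.cell (𝟙 (Loose.mk n)) (frame_glob_id _ n) :=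
  congrArg Glob.cell (leftUnitor_hcomp m n)

theorem triangle_inv {x y z : D} (m : x ⇸ y) (n : y ⇸ z) :
    hcompMap (𝟙 (Loose.mk m)) (leftUnitor n).inv.cell (frame_id_glob m _) ≫
      (hassoc m (hid y) n).inv.cell =
      hcompMap (rightUnitor m).inv.cell (𝟙 (Loose.mk n)) (frame_glob_id _ n) :=
  congrArg Glob.cell (Bicategory.triangle_assoc_comp_left_inv (B := UBicat D) (a := x) (b := y) (c := z) m n)

theorem triangle_inv' {x y z : D} (m : x ⇸ y) (n : y ⇸ z) :
    hcompMap (rightUnitor m).inv.cell (𝟙 (Loose.mk n)) (frame_glob_id _ n) ≫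
      (hassoc m (hid y) n).hom.cell =
      hcompMap (𝟙 (Loose.mk m)) (leftUnitor n).inv.cell (frame_id_glob m _) := by
  rw [← triangle_inv, Category.assoc, iso_inv_hom_cell, Category.comp_id]

theorem hcompMap_eq_id {x y z : D} {m : x ⇸ y} {n : y ⇸ z} {α : Cell m m} {β : Cell n n}
    {h : tgt α = src β} (hα : α = 𝟙 _) (hβ : β = 𝟙 _) :
    hcompMap α β h = 𝟙 (Loose.mk (m ⊙ n)) := by
  subst hα hβ; exact hcompMap_id m n

end Cells

/-! ### Companions as cartesian and opcartesian cells -/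

namespace Companion
variable {D : Type u} [DoubleCategory.{t, w, v} D]

attribute [simp] Companion.src_unit Companion.tgt_unit Companion.src_counit Companion.tgt_counit

/-- The cartesian cell `f_! ⊙ n ⟶ n`. -/
def restr {x x' y : D} {f : x ⟶ x'} (c : Companion f) (n : x' ⇸ y) : Cell (c.pro ⊙ n) n :=
  hcompMap c.counit (𝟙 (Loose.mk n)) (by simp) ≫ (leftUnitor n).hom.cell

/-- The opcartesian cell `m ⟶ m ⊙ g_!`. -/
def extr {x y y' : D} {g : y ⟶ y'} (c : Companion g) (m : x ⇸ y) : Cell m (m ⊙ c.pro) :=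
  (rightUnitor m).inv.cell ≫ hcompMap (𝟙 (Loose.mk m)) c.unit (by simp)

/-- Factorization of a cell through `restr`. -/
def lift {x x' y z w : D} {f : x ⟶ x'} (c : Companion f) {n : x' ⇸ y} {p : z ⇸ w} (u : z ⟶ x)
    (φ : Cell p n) (h : src φ = u ≫ f) : Cell p (c.pro ⊙ n) :=
  (leftUnitor p).inv.cell ≫ hcompMap (hidMap u ≫ c.unit) φ (by simp [h])

/-- Factorization of a cell through `extr`. -/
def desc {x y y' z w : D} {g : y ⟶ y'} (c : Companion g) {m : x ⇸ y} {q : z ⇸ w} (v : y' ⟶ w)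
    (φ : Cell m q) (h : tgt φ = g ≫ v) : Cell (m ⊙ c.pro) q :=
  hcompMap φ (c.counit ≫ hidMap v) (by simp [h]) ≫ (rightUnitor q).hom.cell

section
variable {x x' y z w : D} {f : x ⟶ x'} (c : Companion f)

@[simp] theorem src_restr (n : x' ⇸ y) : src (c.restr n) = f := by simp [restr]
@[simp] theorem tgt_restr (n : x' ⇸ y) : tgt (c.restr n) = 𝟙 y := by simp [restr]
@[simp] theorem src_extr (m : y ⇸ x) : src (c.extr m) = 𝟙 y := by simp [extr]
@[simp] theorem tgt_extr (m : y ⇸ x) : tgt (c.extr m) = f := by simp [extr]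

@[simp] theorem src_lift {n : x' ⇸ y} {p : z ⇸ w} (u : z ⟶ x) (φ : Cell p n)
    (h : src φ = u ≫ f) : src (c.lift u φ h) = u := by simp [lift]
@[simp] theorem tgt_lift {n : x' ⇸ y} {p : z ⇸ w} (u : z ⟶ x) (φ : Cell p n)
    (h : src φ = u ≫ f) : tgt (c.lift u φ h) = tgt φ := by simp [lift]
@[simp] theorem src_desc {m : y ⇸ x} {q : z ⇸ w} (v : x' ⟶ w) (φ : Cell m q)
    (h : tgt φ = f ≫ v) : src (c.desc v φ h) = src φ := by simp [desc]
@[simp] theorem tgt_desc {m : y ⇸ x} {q : z ⇸ w} (v : x' ⟶ w) (φ : Cell m q)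
    (h : tgt φ = f ≫ v) : tgt (c.desc v φ h) = v := by simp [desc]

/-- Existence of the factorization. By interchange the left factor becomes `η ⬝ ε`, an external
identity by the internal law. -/
theorem lift_restr {n : x' ⇸ y} {p : z ⇸ w} (u : z ⟶ x) (φ : Cell p n)
    (h : src φ = u ≫ f) : c.lift u φ h ≫ c.restr n = φ := by
  rw [lift, restr, Category.assoc, hcompMap_comp_assoc]
  refine Eq.trans ?_ (leftUnitor_conj φ h)
  refine congrArg (_ ≫ · ≫ _) (hcompMap_congr ?_ (Category.comp_id _))
  rw [Category.assoc, c.unit_comp_counit, hidMap_comp]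

theorem extr_desc {m : y ⇸ x} {q : z ⇸ w} (v : x' ⟶ w) (φ : Cell m q)
    (h : tgt φ = f ≫ v) : c.extr m ≫ c.desc v φ h = φ := by
  rw [desc, extr, Category.assoc, hcompMap_comp_assoc]
  refine Eq.trans ?_ (rightUnitor_conj φ h)
  refine congrArg (_ ≫ · ≫ _) (hcompMap_congr (Category.id_comp _) ?_)
  rw [← Category.assoc, c.unit_comp_counit, hidMap_comp]

/-- The external law `η ⊙ ε = 1`, whiskered by `n` and rebracketed. It is the source of uniqueness
of factorizations through `restr`. -/
theorem unit_hcomp_restr (n : x' ⇸ y) :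
    (leftUnitor (c.pro ⊙ n)).inv.cell ≫ hcompMap c.unit (c.restr n) (by simp) = 𝟙 _ := by
  have h₁ : hcompMap c.unit (c.restr n) (by simp) =
      hcompMap c.unit (hcompMap c.counit (𝟙 (Loose.mk n)) (by simp)) (by simp) ≫
        hcompMap (𝟙 (Loose.mk c.pro)) (leftUnitor n).hom.cell (by simp) := by
    rw [← hcompMap_comp]
    exact hcompMap_congr (Category.comp_id _).symm rfl
  have h₂ := hassoc_inv_naturality c.unit c.counit (𝟙 (Loose.mk n)) (by simp) (by simp)
  have h₃ := triangle c.pro n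
  -- An inverse pair of associators is inserted: one half turns `1 ⊙ λ` into `ρ ⊙ 1` by the
  -- triangle, the other rebrackets `η ⊙ (ε ⊙ 1)` as `(η ⊙ ε) ⊙ 1`.
  rw [h₁, ← Category.id_comp (hcompMap (𝟙 (Loose.mk c.pro)) (leftUnitor n).hom.cell _),
    ← iso_inv_hom_cell (hassoc c.pro (hid x') n), Category.assoc, h₃, reassoc_of% h₂.symm,
    reassoc_of% (leftUnitor_hcomp_cell c.pro n), ← hcompMap_comp, ← hcompMap_comp]
  exact hcompMap_eq_id (by simpa using c.unit_hcomp_counit) (by simp)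

theorem extr_hcomp_counit (m : y ⇸ x) :
    hcompMap (c.extr m) c.counit (by simp) ≫ (rightUnitor (m ⊙ c.pro)).hom.cell = 𝟙 _ := by
  have h₁ : hcompMap (c.extr m) c.counit (by simp) =
      hcompMap (rightUnitor m).inv.cell (𝟙 (Loose.mk c.pro)) (by simp) ≫
      hcompMap (hcompMap (𝟙 (Loose.mk m)) c.unit (by simp)) c.counit (by simp) := by
    rw [← hcompMap_comp]
    exact hcompMap_congr rfl (Category.id_comp _).symm
  have h₂ := hassoc_naturality (𝟙 (Loose.mk m)) c.unit c.counit (by simp) (by simp)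
  have h₃ := triangle_inv' m c.pro
  have h₄ : (hassoc m c.pro (hid x')).hom.cell ≫
      hcompMap (𝟙 (Loose.mk m)) (rightUnitor c.pro).hom.cell (frame_id_glob m _) =
        (rightUnitor (m ⊙ c.pro)).hom.cell :=
    congrArg Glob.cell (Bicategory.rightUnitor_comp (B := UBicat D) m c.pro).symm
  rw [h₁, ← h₄, Category.assoc, reassoc_of% h₂, reassoc_of% h₃, ← hcompMap_comp, ← hcompMap_comp]
  exact hcompMap_eq_id (by simp) (by simpa using c.unit_hcomp_counit)

theorem lift_comp_restr {n : x' ⇸ y} {p : z ⇸ w} (ψ : Cell p (c.pro ⊙ n)) :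
    c.lift (src ψ) (ψ ≫ c.restr n) (by simp) = ψ := by
  rw [lift, hcompMap_comp (hidMap (src ψ)) ψ c.unit (c.restr n) (by simp) (by simp),
    ← Category.assoc, leftUnitor_inv_naturality ψ rfl, Category.assoc, unit_hcomp_restr,
    Category.comp_id]

theorem desc_extr_comp {m : y ⇸ x} {q : z ⇸ w} (ψ : Cell (m ⊙ c.pro) q) :
    c.desc (tgt ψ) (c.extr m ≫ ψ) (by simp) = ψ := by
  rw [desc, hcompMap_comp (c.extr m) c.counit ψ (hidMap (tgt ψ)) (by simp) (by simp),
    Category.assoc, rightUnitor_naturality ψ, reassoc_of% (c.extr_hcomp_counit m)]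

theorem restr_ext {n : x' ⇸ y} {p : z ⇸ w} {ψ ψ' : Cell p (c.pro ⊙ n)}
    (hs : src ψ = src ψ') (h : ψ ≫ c.restr n = ψ' ≫ c.restr n) : ψ = ψ' := by
  rw [← c.lift_comp_restr ψ, ← c.lift_comp_restr ψ']
  congr 1

/-- The standard test below for equations between cells out of `m ⊙ f_!`. Only right boundaries need
comparing, since `extr` has an identity on the left. -/
theorem extr_ext {m : y ⇸ x} {q : z ⇸ w} {ψ ψ' : Cell (m ⊙ c.pro) q}
    (ht : tgt ψ = tgt ψ') (h : c.extr m ≫ ψ = c.extr m ≫ ψ') : ψ = ψ' := by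
  rw [← c.desc_extr_comp ψ, ← c.desc_extr_comp ψ']
  congr 1

/-- Inserting `η ⊙ ε = 1` before `ψ` recovers it as `(η ⬝ ψ) ⊙ (ε ⬝ id)`, up to unitors, with `id`
the external identity on the right boundary of `ψ`. -/
theorem unit_ext {q : z ⇸ w} {ψ ψ' : Cell c.pro q}
    (ht : tgt ψ = tgt ψ') (h : c.unit ≫ ψ = c.unit ≫ ψ') : ψ = ψ' := by
  have key : ∀ ψ : Cell c.pro q, ψ = (leftUnitor c.pro).inv.cell ≫
      hcompMap (c.unit ≫ ψ) (c.counit ≫ hidMap (tgt ψ)) (by simp) ≫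
        (rightUnitor q).hom.cell := fun ψ => by
    rw [hcompMap_comp c.unit c.counit ψ (hidMap (tgt ψ)) (by simp) (by simp), Category.assoc,
      rightUnitor_naturality ψ, reassoc_of% c.unit_hcomp_counit]
  rw [key ψ, key ψ']
  exact congrArg (_ ≫ · ≫ _) (hcompMap_congr h (by rw [ht]))

theorem lift_precomp {n : x' ⇸ y} {a b : D} {p : z ⇸ w} {p' : a ⇸ b} (κ : Cell p' p)
    (u : z ⟶ x) (φ : Cell p n) (h : src φ = u ≫ f) :
    κ ≫ c.lift u φ h = c.lift (src κ ≫ u) (κ ≫ φ) (by simp [h]) :=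
  c.restr_ext (by simp) (by rw [Category.assoc, lift_restr, lift_restr])

theorem lift_congr {n : x' ⇸ y} {p : z ⇸ w} {u u' : z ⟶ x} {φ φ' : Cell p n}
    {h : src φ = u ≫ f} (hu : u = u') (hφ : φ = φ') :
    c.lift u φ h = c.lift u' φ' (by rw [← hu, ← hφ, h]) := by
  subst hu hφ; rfl

theorem hidMap_one_unit : hidMap (𝟙 x) ≫ c.unit = c.unit := by
  rw [hidMap_id, Category.id_comp]

theorem counit_hidMap_one : c.counit ≫ hidMap (𝟙 x') = c.counit := by
  rw [hidMap_id, Category.comp_id]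

theorem lift_one {n : x' ⇸ y} {p : x ⇸ w} (φ : Cell p n) (h : src φ = f) :
    c.lift (𝟙 x) φ (by simp [h]) =
      (leftUnitor p).inv.cell ≫ hcompMap c.unit φ (by simp [h]) :=
  congrArg (_ ≫ ·) (hcompMap_congr c.hidMap_one_unit rfl)

theorem desc_one {m : y ⇸ x} {q : z ⇸ x'} (φ : Cell m q) (h : tgt φ = f) :
    c.desc (𝟙 x') φ (by simp [h]) =
      hcompMap φ c.counit (by simp [h]) ≫ (rightUnitor q).hom.cell :=
  congrArg (· ≫ _) (hcompMap_congr rfl c.counit_hidMap_one)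

end

/-! ### Functoriality of companions in commutative squares -/

section
variable {x y x' y' : D} {f : x ⟶ y} {g : x' ⟶ y'} (c : Companion f) (d : Companion g)

/-- The cell `f_! ⟶ g_!` induced by a commutative square of arrows. -/
def map (u : x ⟶ x') (v : y ⟶ y') (h : u ≫ g = f ≫ v) : Cell c.pro d.pro :=
  (leftUnitor c.pro).inv.cell ≫
    hcompMap (hidMap u ≫ d.unit) (c.counit ≫ hidMap v) (by simp [h]) ≫
      (rightUnitor d.pro).hom.cell

@[simp] theorem src_map (u : x ⟶ x') (v : y ⟶ y') (h : u ≫ g = f ≫ v) :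
    src (c.map d u v h) = u := by simp [map]

@[simp] theorem tgt_map (u : x ⟶ x') (v : y ⟶ y') (h : u ≫ g = f ≫ v) :
    tgt (c.map d u v h) = v := by simp [map]

/-- Pulling `η` through the left unitor and interchanging leaves `id_u ⬝ η` beside `η ⬝ ε ⬝ id_v`.
The latter is the external identity on `f ≫ v = u ≫ g` and drops out. -/
theorem unit_map (u : x ⟶ x') (v : y ⟶ y') (h : u ≫ g = f ≫ v) :
    c.unit ≫ c.map d u v h = hidMap u ≫ d.unit := by
  rw [map, ← Category.assoc, ← leftUnitor_inv_naturality c.unit c.src_unit, Category.assoc,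
    hcompMap_comp_assoc]
  refine Eq.trans ?_ (rightUnitor_conj (hidMap u ≫ d.unit) (v := u ≫ g) (by simp))
  rw [unitors_hid]
  refine congrArg (_ ≫ · ≫ _) (hcompMap_congr ?_ ?_)
  · rw [hidMap_id, Category.id_comp]
  · rw [← Category.assoc, c.unit_comp_counit, h, hidMap_comp]

theorem map_counit (u : x ⟶ x') (v : y ⟶ y') (h : u ≫ g = f ≫ v) :
    c.map d u v h ≫ d.counit = c.counit ≫ hidMap v := by
  have e := rightUnitor_naturality' d.counit d.tgt_counit
  rw [map, Category.assoc, Category.assoc, ← e, hcompMap_comp_assoc]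
  refine Eq.trans ?_ (leftUnitor_conj (c.counit ≫ hidMap v) (u := u ≫ g) (by simp [h]))
  rw [unitors_hid]
  refine congrArg (_ ≫ · ≫ _) (hcompMap_congr ?_ ?_)
  · rw [Category.assoc, d.unit_comp_counit, hidMap_comp]
  · rw [hidMap_id, Category.comp_id]

end

/-! ### The sliding cell through its universal property -/

section
variable {x y x' y' : D} {m : x ⇸ y} {n : x' ⇸ y'} {f : x ⟶ x'} {g : y ⟶ y'}
  (cf : Companion f) (cg : Companion g) (α : Cell m n) (hf : src α = f) (hg : tgt α = g)

/-- Sliding is a pair of factorizations: `lift` absorbs the left boundary into `f_!`, then `desc`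
absorbs the right boundary into `g_!`. -/
theorem slideCompanion_eq_desc_lift :
    (slideCompanion cf cg α hf hg).cell =
      cg.desc (𝟙 _) (cf.lift (𝟙 _) α (by simp [hf])) (by simp [hg]) := by
  have e : hcompMap (cf.lift (𝟙 _) α (by simp [hf])) cg.counit (by simp [hg]) =
      hcompMap (leftUnitor m).inv.cell (𝟙 (Loose.mk cg.pro)) (by simp) ≫
        hcompMap (hcompMap cf.unit α (by simp [hf])) cg.counit (by simp [hg]) := by
    rw [← hcompMap_comp]
    exact hcompMap_congr (cf.lift_one α hf) (Category.id_comp _).symm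
  rw [desc_one _ _ (by simp [hg]), e, Category.assoc]
  rfl

theorem extr_slideCompanion :
    cg.extr m ≫ (slideCompanion cf cg α hf hg).cell = cf.lift (𝟙 _) α (by simp [hf]) := by
  rw [slideCompanion_eq_desc_lift, extr_desc]

theorem slideCompanion_restr :
    (slideCompanion cf cg α hf hg).cell ≫ cf.restr n = cg.desc (𝟙 _) α (by simp [hg]) :=
  cg.extr_ext (by simp) (by
    rw [← Category.assoc, extr_slideCompanion, lift_restr, extr_desc])

/-- One composite is tested on the opcartesian cell, using `h₁`, the other on the cartesian cell,
using `h₂`. The hypotheses have the form in which equivariance of a unit and of a counit delivers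
them. -/
theorem isIso_slideCompanion (T : cf.pro ⊙ n ⟶ m ⊙ cg.pro)
    (h₁ : cf.lift (𝟙 _) α (by simp [hf]) ≫ T.cell = cg.extr m)
    (h₂ : T.cell ≫ cg.desc (𝟙 _) α (by simp [hg]) = cf.restr n) :
    IsIso (slideCompanion cf cg α hf hg) := by
  refine ⟨T, glob_ext (cg.extr_ext (by simp) ?_), glob_ext (cf.restr_ext (by simp) ?_)⟩
  · rw [glob_comp_cell, ← Category.assoc, extr_slideCompanion, h₁, glob_id_cell, Category.comp_id]
  · rw [glob_comp_cell, Category.assoc, slideCompanion_restr, h₂, glob_id_cell, Category.id_comp]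

theorem lift_inv_slideCompanion [IsIso (slideCompanion cf cg α hf hg)] :
    cf.lift (𝟙 _) α (by simp [hf]) ≫ (inv (slideCompanion cf cg α hf hg)).cell = cg.extr m := by
  rw [← extr_slideCompanion cf cg α hf hg, Category.assoc, ← glob_comp_cell, IsIso.hom_inv_id,
    glob_id_cell, Category.comp_id]

theorem inv_slideCompanion_desc [IsIso (slideCompanion cf cg α hf hg)] :
    (inv (slideCompanion cf cg α hf hg)).cell ≫ cg.desc (𝟙 _) α (by simp [hg]) = cf.restr n := by
  rw [← slideCompanion_restr cf cg α hf hg, ← Category.assoc, ← glob_comp_cell, IsIso.inv_hom_id,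
    glob_id_cell, Category.id_comp]

/-- Two companions of one arrow are linked by canonical globular cells compatible with units and
counits. Conjugating the inverse by these cells gives the inverse for the new choice. -/
theorem isIso_slideCompanion_of_isIso (cf' : Companion f) (cg' : Companion g)
    [IsIso (slideCompanion cf cg α hf hg)] : IsIso (slideCompanion cf' cg' α hf hg) := by
  have hg' : tgt α = g ≫ 𝟙 _ := by simp [hg]
  refine isIso_slideCompanion cf' cg' α hf hg
    ⟨hcompMap (cf'.map cf (𝟙 _) (𝟙 _) (by simp)) (𝟙 (Loose.mk n)) (by simp) ≫
      (inv (slideCompanion cf cg α hf hg)).cell ≫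
      hcompMap (𝟙 (Loose.mk m)) (cg.map cg' (𝟙 _) (𝟙 _) (by simp)) (by simp),
      by simp, by simp⟩ ?_ ?_
  · have e : cf'.lift (𝟙 _) α (by simp [hf]) ≫
        hcompMap (cf'.map cf (𝟙 _) (𝟙 _) (by simp)) (𝟙 (Loose.mk n)) (by simp) =
        cf.lift (𝟙 _) α (by simp [hf]) := by
      rw [lift_one _ _ hf, lift_one _ _ hf, Category.assoc, ← hcompMap_comp]
      refine congrArg (_ ≫ ·) (hcompMap_congr ?_ (Category.comp_id _))
      rw [unit_map, hidMap_one_unit]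
    dsimp only
    rw [reassoc_of% e, ← Category.assoc, lift_inv_slideCompanion, extr, Category.assoc,
      ← hcompMap_comp, extr]
    refine congrArg (_ ≫ ·) (hcompMap_congr (Category.comp_id _) ?_)
    rw [unit_map, hidMap_one_unit]
  · have e : hcompMap (𝟙 (Loose.mk m)) (cg.map cg' (𝟙 _) (𝟙 _) (by simp)) (by simp) ≫
        cg'.desc (𝟙 _) α hg' = cg.desc (𝟙 _) α hg' := by
      rw [desc_one _ _ hg, desc_one _ _ hg, hcompMap_comp_assoc]
      refine congrArg (· ≫ _) (hcompMap_congr (Category.id_comp _) ?_)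
      rw [map_counit, counit_hidMap_one]
    dsimp only
    rw [Category.assoc, Category.assoc, e, inv_slideCompanion_desc, restr, hcompMap_comp_assoc,
      restr]
    refine congrArg (· ≫ _) (hcompMap_congr ?_ (Category.comp_id _))
    rw [map_counit, counit_hidMap_one]

end

end Companion

/-! ### Naturality and coherence of sliding along companions -/

namespace Companion
section
variable {D : Type u} [DoubleCategory.{t, w, v} D]

/-- Compatibility `hκ` with the units is all that is asked of `κ`, so the lemma covers both the
cells `map` and identities. -/
theorem extr_hcompMap {x y x' y' z z' : D} {g : y ⟶ z} {g' : y' ⟶ z'} (c : Companion g)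
    (c' : Companion g') {m : x ⇸ y} {m' : x' ⇸ y'} (γ : Cell m m') (κ : Cell c.pro c'.pro)
    (h : tgt γ = src κ) (hκ : c.unit ≫ κ = hidMap (src κ) ≫ c'.unit) :
    c.extr m ≫ hcompMap γ κ h = γ ≫ c'.extr m' := by
  rw [extr, extr, ← Category.assoc, ← rightUnitor_inv_naturality γ h, Category.assoc,
    Category.assoc, ← hcompMap_comp, ← hcompMap_comp]
  exact congrArg (_ ≫ ·) (hcompMap_congr (by simp) hκ)

theorem lift_hcompMap {x y x' y' z w z' : D} {f : x ⟶ y} {f' : x' ⟶ y'} (c : Companion f)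
    (c' : Companion f') {m : x ⇸ z} {n : y ⇸ w} {n' : y' ⇸ z'} (φ : Cell m n) (hφ : src φ = f)
    (κ : Cell c.pro c'.pro) (δ : Cell n n') (h : tgt κ = src δ)
    (hκ : c.unit ≫ κ = hidMap (src κ) ≫ c'.unit) :
    c.lift (𝟙 x) φ (by simp [hφ]) ≫ hcompMap κ δ h =
      -- Right boundaries in `hκ` give `f ≫ tgt κ = src κ ≫ f'`, the frame condition for this lift.
      c'.lift (src κ) (φ ≫ δ) (by simpa [← h, hφ] using congrArg tgt hκ) := by
  rw [lift_one _ _ hφ, lift, Category.assoc, ← hcompMap_comp]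
  exact congrArg (_ ≫ ·) (hcompMap_congr hκ rfl)

/-- Tested on `extr`, the two sides become the lifts of `α ≫ δ` and `γ ≫ β`, which agree by `h`. -/
theorem slideCompanion_naturality {x y x' y' a b a' b' : D} {m : x ⇸ y} {n : x' ⇸ y'}
    {p : a ⇸ b} {q : a' ⇸ b'} {f : x ⟶ x'} {g : y ⟶ y'} {f' : a ⟶ a'} {g' : b ⟶ b'}
    (cf : Companion f) (cg : Companion g) (cf' : Companion f') (cg' : Companion g')
    (α : Cell m n) (hf : src α = f) (hg : tgt α = g)
    (β : Cell p q) (hf' : src β = f') (hg' : tgt β = g') (γ : Cell m p) (δ : Cell n q)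
    (h : γ ≫ β = α ≫ δ) (κ : Cell cf.pro cf'.pro) (κ' : Cell cg.pro cg'.pro)
    (h₁ : tgt κ = src δ) (h₂ : tgt γ = src κ') (h₃ : src κ = src γ) (h₄ : tgt κ' = tgt δ)
    (hκ : cf.unit ≫ κ = hidMap (src κ) ≫ cf'.unit)
    (hκ' : cg.unit ≫ κ' = hidMap (src κ') ≫ cg'.unit) :
    (slideCompanion cf cg α hf hg).cell ≫ hcompMap κ δ h₁ =
      hcompMap γ κ' h₂ ≫ (slideCompanion cf' cg' β hf' hg').cell := by
  refine cg.extr_ext (by simp [h₄]) ?_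
  have e := lift_hcompMap cf cf' α hf κ δ h₁ hκ
  rw [← Category.assoc, extr_slideCompanion, e, ← Category.assoc,
    extr_hcompMap _ _ _ _ h₂ hκ', Category.assoc, extr_slideCompanion, lift_precomp]
  exact lift_congr _ (by simp [h₃]) h.symm

/-- Precomposed with `extr`, the right-hand side passes the new boundary from `h_!` to `g_!` to
`f_!`, and each passage trades an `extr` for a `lift`. What remains is the lift of `(α ⊙ β) ⬝ ψ`, to
be compared with that of `φ ⬝ γ`. -/
theorem slideCompanion_hcomp {x y z x' y' z' : D} {m : x ⇸ y} {m' : y ⇸ z} {m'' : x ⇸ z}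
    {n : x' ⇸ y'} {n' : y' ⇸ z'} {n'' : x' ⇸ z'} {f : x ⟶ x'} {g : y ⟶ y'} {h : z ⟶ z'}
    (cf : Companion f) (cg : Companion g) (ch : Companion h)
    (α : Cell m n) (hf : src α = f) (hg : tgt α = g)
    (β : Cell m' n') (hf' : src β = g) (hg' : tgt β = h)
    (γ : Cell m'' n'') (hf'' : src γ = f) (hg'' : tgt γ = h)
    (φ : m ⊙ m' ⟶ m'') (ψ : n ⊙ n' ⟶ n'')
    (e : φ.cell ≫ γ = hcompMap α β (hg.trans hf'.symm) ≫ ψ.cell) :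
    φ ▷ₚ ch.pro ≫ slideCompanion cf ch γ hf'' hg'' =
      (hassoc _ _ _).hom ≫ m ◁ₚ slideCompanion cg ch β hf' hg' ≫ (hassoc _ _ _).inv ≫
        slideCompanion cf cg α hf hg ▷ₚ n' ≫ (hassoc _ _ _).hom ≫ cf.pro ◁ₚ ψ := by
  have e₁ : ch.extr (m ⊙ m') ≫ (hassoc _ _ _).hom.cell =
      hcompMap (𝟙 (Loose.mk m)) (ch.extr m') (by simp) := by
    have h := hassoc_naturality (𝟙 (Loose.mk m)) (𝟙 (Loose.mk m')) ch.unit (by simp) (by simp)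
    rw [extr, hcompMap_congr (hcompMap_id m m').symm rfl, Category.assoc, h,
      reassoc_of% (rightUnitor_hcomp_cell m m'), ← hcompMap_comp]
    exact hcompMap_congr (by simp) rfl
  -- The exchange at the middle arrow: the unit of `g_!` between `m` and `β` may be attached to
  -- either neighbour, as the lift of `β` or as the extension of `m`.
  have e₂ : hcompMap (𝟙 (Loose.mk m)) (cg.lift (𝟙 _) β (by simp [hf'])) (by simp) ≫
      (hassoc _ _ _).inv.cell = hcompMap (cg.extr m) β (by simp [hf']) := by
    have h := hassoc_inv_naturality (𝟙 (Loose.mk m)) cg.unit β (by simp) (by simp [hf'])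
    have e : hcompMap (𝟙 (Loose.mk m)) (cg.lift (𝟙 _) β (by simp [hf'])) (by simp) =
        hcompMap (𝟙 (Loose.mk m)) (leftUnitor m').inv.cell (by simp) ≫
        hcompMap (𝟙 (Loose.mk m)) (hcompMap cg.unit β (by simp [hf'])) (by simp) := by
      rw [← hcompMap_comp]
      exact hcompMap_congr (Category.comp_id _).symm (lift_one _ _ hf')
    rw [e, Category.assoc, ← h, reassoc_of% (triangle_inv m m'), ← hcompMap_comp]
    exact hcompMap_congr rfl (by simp)
  have e₃ : hcompMap (cf.lift (𝟙 _) α (by simp [hf])) β (by simp [hg, hf']) ≫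
      (hassoc _ _ _).hom.cell =
      cf.lift (𝟙 _) (hcompMap α β (hg.trans hf'.symm)) (by simp [hf]) := by
    have h := hassoc_naturality cf.unit α β (by simp [hf]) (by simp [hg, hf'])
    have e : hcompMap (cf.lift (𝟙 _) α (by simp [hf])) β (by simp [hg, hf']) =
        hcompMap (leftUnitor m).inv.cell (𝟙 (Loose.mk m')) (by simp) ≫
        hcompMap (hcompMap cf.unit α (by simp [hf])) β (by simp [hg, hf']) := by
      rw [← hcompMap_comp]
      exact hcompMap_congr (lift_one _ _ hf) (Category.id_comp _).symm
    rw [e, Category.assoc, h, ← leftUnitor_hcomp_cell, Category.assoc,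
      iso_inv_hom_cell_assoc, lift_one _ _ (by simp [hf])]
  have e₄ := lift_hcompMap cf cf (hcompMap α β (hg.trans hf'.symm)) (by simp [hf]) (𝟙 _) ψ.cell
    (by simp) (by simp [hidMap_id])
  refine glob_ext (ch.extr_ext (by simp) ?_)
  simp only [glob_comp_cell, whiskerL, whiskerR]
  rw [← Category.assoc, extr_hcompMap ch ch φ.cell (𝟙 _) (by simp) (by simp [hidMap_id]),
    Category.assoc, extr_slideCompanion, lift_precomp, reassoc_of% e₁, hcompMap_comp_assoc]
  rw [hcompMap_congr (Category.comp_id _) (extr_slideCompanion cg ch β hf' hg'), reassoc_of% e₂,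
    hcompMap_comp_assoc,
    hcompMap_congr (extr_slideCompanion cf cg α hf hg) (Category.comp_id _), reassoc_of% e₃, e₄]
  exact lift_congr _ (by simp) e

theorem slideCompanion_hid {x y : D} {f : x ⟶ y} (c : Companion f) {m : x ⇸ x} {n : y ⇸ y}
    (α : Cell m n) (hf : src α = f) (hg : tgt α = f) (φ : hid x ⟶ m) (ψ : hid y ⟶ n)
    (e : φ.cell ≫ α = hidMap f ≫ ψ.cell) :
    φ ▷ₚ c.pro ≫ slideCompanion c c α hf hg =
      (leftUnitor _).hom ≫ (rightUnitor _).inv ≫ c.pro ◁ₚ ψ := by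
  refine glob_ext (c.extr_ext (by simp) ?_)
  simp only [glob_comp_cell, whiskerL, whiskerR]
  rw [← Category.assoc, extr_hcompMap c c φ.cell (𝟙 _) (by simp) (by simp [hidMap_id]),
    Category.assoc, extr_slideCompanion, lift_precomp]
  -- On an external identity, the opcartesian cell is the unit `η` up to a unitor.
  have e₁ : c.extr (hid x) ≫ (leftUnitor c.pro).hom.cell = c.unit := by
    rw [extr, ← unitors_hid, hcompMap_congr (hidMap_id x).symm rfl, Category.assoc,
      leftUnitor_conj _ c.src_unit]
  rw [reassoc_of% e₁, ← reassoc_of% (rightUnitor_inv_naturality c.unit c.tgt_unit),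
    ← hcompMap_comp]
  refine (lift_congr c (u' := 𝟙 x) (by simp) e).trans ?_
  rw [lift_one _ _ (by simp), unitors_hid]
  exact congrArg (_ ≫ ·) (hcompMap_congr (by simp) rfl)

end
end Companion

/-- `IsCommuter` refers to companions of `src α` and `tgt α`, but the boundaries of a component cell
equal the component arrows only propositionally. Naming them `f` and `g` bridges this. -/
theorem IsCommuter.isIso {D : Type u} [DoubleCategory.{t, w, v} D] {x y x' y' : D}
    {m : x ⇸ y} {n : x' ⇸ y'} {α : Cell m n} (hα : IsCommuter α) {f : x ⟶ x'} {g : y ⟶ y'}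
    (cf : Companion f) (cg : Companion g) (hf : src α = f) (hg : tgt α = g) :
    IsIso (slideCompanion cf cg α hf hg) := by
  subst hf hg
  exact hα.2.2 cf cg

/-! ### The companion of a natural transformation from componentwise companions -/

section
variable {D : Type u₁} [DoubleCategory.{t₁, w₁, v₁} D]
variable {E : Type u₂} [DoubleCategory.{t₂, w₂, v₂} E]
variable {F G : LaxDoubleFunctor D E} (α : NatTransf F G)

namespace NatTransf

/-- The globular cell obtained from a component cell of `α` by sliding. -/
abbrev slide (c : ∀ x, Companion (α.app x)) {x y : D} (m : x ⇸ y) :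
    F.mapPro m ⊙ (c y).pro ⟶ (c x).pro ⊙ G.mapPro m :=
  slideCompanion (c x) (c y) (α.cell m) (α.src_cell m) (α.tgt_cell m)

variable (c : ∀ x, Companion (α.app x))
  [hc : ∀ {x y : D} (m : x ⇸ y), IsIso (α.slide c m)]

/-- The pseudo protransformation `F ⇸ G` with components the companions of those of `α`. -/
noncomputable def companionProtransf : PseudoProtransf F G where
  pro x := (c x).pro
  arr {x y} f := (c x).map (c y) (F.map f) (G.map f) (α.naturality f)
  src_arr f := by simp
  tgt_arr f := by simp
  comparison m := inv (α.slide c m)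
  isIso_comparison m := inferInstance
  arr_id x := (c x).unit_ext (by simp) (by
    rw [Companion.unit_map, F.map_id, hidMap_id, Category.id_comp, Category.comp_id])
  arr_comp {x y z} f g := (c x).unit_ext (by simp) (by
    rw [Companion.unit_map, reassoc_of% ((c x).unit_map (c y)), Companion.unit_map, F.map_comp,
      hidMap_comp, Category.assoc])
  naturality {x y x' y' m n} γ := by
    have h := Companion.slideCompanion_naturality (c x) (c y) (c x') (c y') (α.cell m)
      (α.src_cell m) (α.tgt_cell m) (α.cell n) (α.src_cell n) (α.tgt_cell n)
      (F.mapCell γ) (G.mapCell γ) (α.cell_naturality γ)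
      ((c x).map (c x') (F.map (src γ)) (G.map (src γ)) (α.naturality _))
      ((c y).map (c y') (F.map (tgt γ)) (G.map (tgt γ)) (α.naturality _))
      (by simp) (by simp) (by simp) (by simp) (by simp [Companion.unit_map])
      (by simp [Companion.unit_map])
    -- Naturality of the slide is a square with slides on two opposite sides; inverting both gives
    -- naturality of the comparison.
    exact inv_sq (asIso (α.slide c m)) (asIso (α.slide c n)) h.symm
  comparison_hcomp {x y z} m n := by
    have h := Companion.slideCompanion_hcomp (c x) (c y) (c z) (α.cell m) (α.src_cell m)
      (α.tgt_cell m) (α.cell n) (α.src_cell n) (α.tgt_cell n) (α.cell (m ⊙ n))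
      (α.src_cell _) (α.tgt_cell _) (F.laxComp m n) (G.laxComp m n) (α.cell_hcomp m n)
    have h₁ : F.mapPro m ◁ₚ inv (α.slide c n) ≫ F.mapPro m ◁ₚ α.slide c n = 𝟙 _ := by
      rw [← whiskerL_comp, IsIso.inv_hom_id, whiskerL_id]
    have h₂ : inv (α.slide c m) ▷ₚ G.mapPro n ≫ α.slide c m ▷ₚ G.mapPro n = 𝟙 _ := by
      rw [← comp_whiskerR, IsIso.inv_hom_id, id_whiskerR]
    -- Moving the inverse for `m ⊙ n` to the other side lets `h` apply to the end of the composite.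
    -- The slides it produces cancel against the remaining inverses, the later one first.
    rw [IsIso.comp_inv_eq]
    simp only [Category.assoc]
    rw [h, Iso.inv_hom_id_assoc, reassoc_of% h₁, Iso.hom_inv_id_assoc, reassoc_of% h₂,
      Iso.inv_hom_id_assoc]
  comparison_hid x := by
    have h := Companion.slideCompanion_hid (c x) (α.cell (hid x)) (α.src_cell _) (α.tgt_cell _)
      (F.laxId x) (G.laxId x) (α.cell_hid x)
    rw [IsIso.comp_inv_eq]
    simp only [Category.assoc]
    rw [h, Iso.inv_hom_id_assoc, Iso.hom_inv_id_assoc]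

/-- The companion of `α` with components the companions of those of `α`. -/
noncomputable def companion : Companion (D := LaxPs D E) (x := F) (y := G) α where
  pro := α.companionProtransf c
  unit :=
    { left := 𝟙 F
      right := α
      app := fun x => (c x).unit
      src_app := fun x => (c x).src_unit
      tgt_app := fun x => (c x).tgt_unit
      arr_equivariance := fun {x y} f => (c x).unit_map (c y) _ _ (α.naturality f)
      pro_equivariance := fun {x y} m => by
        have h := Companion.lift_inv_slideCompanion (c x) (c y) (α.cell m) (α.src_cell m)
          (α.tgt_cell m)
        rw [Companion.lift_one _ _ (α.src_cell m), Category.assoc] at h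
        -- The comparison of the identity protransformation is `λ ≫ ρ⁻¹`. Since `h` begins with
        -- `λ⁻¹` on one side and `ρ⁻¹` on the other, prefixing `λ` turns it into the equivariance
        -- condition.
        refine (iso_hom_inv_cell_assoc (leftUnitor (F.mapPro m)) _).symm.trans ?_
        exact (congrArg (_ ≫ ·) h).trans (Category.assoc _ _ _).symm }
  src_unit := rfl
  tgt_unit := rfl
  counit :=
    { left := α
      right := 𝟙 G
      app := fun x => (c x).counit
      src_app := fun x => (c x).src_counit
      tgt_app := fun x => (c x).tgt_counit
      arr_equivariance := fun {x y} f => ((c x).map_counit (c y) _ _ (α.naturality f)).symm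
      pro_equivariance := fun {x y} m => by
        have h := Companion.inv_slideCompanion_desc (c x) (c y) (α.cell m) (α.src_cell m)
          (α.tgt_cell m)
        rw [Companion.desc_one _ _ (α.tgt_cell m)] at h
        refine (Category.assoc _ _ _).symm.trans ((congrArg (· ≫ _) h.symm).trans ?_)
        refine (Category.assoc _ _ _).trans (congrArg (_ ≫ ·) ?_)
        refine (Category.assoc _ _ _).trans ?_
        exact (congrArg (_ ≫ ·) (iso_hom_inv_cell _)).trans (Category.comp_id _) }
  src_counit := rfl
  tgt_counit := rfl
  unit_hcomp_counit := Modif.ext' ((Category.id_comp _).trans (Category.comp_id _))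
    ((Category.id_comp _).trans (Category.comp_id _)) (fun x => (c x).unit_hcomp_counit)
  unit_comp_counit := Modif.ext' (Category.id_comp _) (Category.comp_id _)
    (fun x => (c x).unit_comp_counit)

end NatTransf
end

theorem isCommuter_of_isIso {D : Type u} [DoubleCategory.{t, w, v} D] {x y x' y' : D}
    {m : x ⇸ y} {n : x' ⇸ y'} {α : Cell m n} {f : x ⟶ x'} {g : y ⟶ y'}
    (cf : Companion f) (cg : Companion g) (hf : src α = f) (hg : tgt α = g)
    (h : IsIso (slideCompanion cf cg α hf hg)) : IsCommuter α := by
  subst hf hg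
  exact ⟨⟨cf⟩, ⟨cg⟩, fun cf' cg' =>
    Companion.isIso_slideCompanion_of_isIso cf cg α rfl rfl cf' cg'⟩

/-! ### Components of a companion, and the first equivalence -/

section
variable {D : Type u₁} [DoubleCategory.{t₁, w₁, v₁} D]
variable {E : Type u₂} [DoubleCategory.{t₂, w₂, v₂} E]
variable {F G : LaxDoubleFunctor D E} {α : NatTransf F G}

/-- The component at `x` of a companion in `LaxPs D E`. -/
def Companion.component (C : Companion (D := LaxPs D E) (x := F) (y := G) α) (x : D) :
    Companion (α.app x) where
  pro := (LaxPs.toProtransf C.pro).pro x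
  unit := Modif.app C.unit x
  src_unit := (Modif.src_app C.unit x).trans
    (congrArg (fun β : NatTransf F F => β.app x) C.src_unit)
  tgt_unit := (Modif.tgt_app C.unit x).trans
    (congrArg (fun β : NatTransf F G => β.app x) C.tgt_unit)
  counit := Modif.app C.counit x
  src_counit := (Modif.src_app C.counit x).trans
    (congrArg (fun β : NatTransf F G => β.app x) C.src_counit)
  tgt_counit := (Modif.tgt_app C.counit x).trans
    (congrArg (fun β : NatTransf G G => β.app x) C.tgt_counit)
  unit_hcomp_counit := congrArg (fun μ => Modif.app μ x) C.unit_hcomp_counit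
  unit_comp_counit := congrArg (fun μ => Modif.app μ x) C.unit_comp_counit

/-- The comparison of `C.pro` is the inverse: equivariance of the unit and of the counit of `C` are
the two equations required of it, once their boundary transformations are identified with `α` and
identities. -/
theorem Companion.isIso_slide_component (C : Companion (D := LaxPs D E) (x := F) (y := G) α)
    {x y : D} (m : x ⇸ y) : IsIso (α.slide C.component m) := by
  refine isIso_slideCompanion (C.component x) (C.component y) (α.cell m) (α.src_cell m)
    (α.tgt_cell m) ((LaxPs.toProtransf C.pro).comparison m) ?_ ?_
  · have h := Modif.pro_equivariance C.unit m
    have h₁ : (Modif.left C.unit).cell m = 𝟙 _ :=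
      congrArg (fun β : NatTransf F F => β.cell m) C.src_unit
    have h₂ : (Modif.right C.unit).cell m = α.cell m :=
      congrArg (fun β : NatTransf F G => β.cell m) C.tgt_unit
    rw [hcompMap_congr rfl h₂, hcompMap_congr h₁ rfl] at h
    rw [lift_one _ _ (α.src_cell m), Category.assoc]
    refine (congrArg (_ ≫ ·) (h.trans (Category.assoc _ _ _))).trans ?_
    exact iso_inv_hom_cell_assoc (leftUnitor (F.mapPro m)) _
  · have h := Modif.pro_equivariance C.counit m
    have h₁ : (Modif.left C.counit).cell m = α.cell m :=
      congrArg (fun β : NatTransf F G => β.cell m) C.src_counit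
    have h₂ : (Modif.right C.counit).cell m = 𝟙 _ :=
      congrArg (fun β : NatTransf G G => β.cell m) C.tgt_counit
    rw [hcompMap_congr rfl h₂, hcompMap_congr h₁ rfl] at h
    rw [desc_one _ _ (α.tgt_cell m), ← Category.assoc]
    refine (congrArg (· ≫ _) h.symm).trans ?_
    refine (Category.assoc _ _ _).trans (congrArg (_ ≫ ·) ?_)
    refine (Category.assoc _ _ _).trans ?_
    exact (congrArg (_ ≫ ·) (iso_inv_hom_cell _)).trans (Category.comp_id _)

variable (α) in
theorem hasCompanion_iff : HasCompanion (D := LaxPs D E) (x := F) (y := G) α ↔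
    (∀ x : D, HasCompanion (α.app x)) ∧ ∀ (x y : D) (m : x ⇸ y), IsCommuter (α.cell m) := by
  refine ⟨fun ⟨C⟩ => ⟨fun x => ⟨C.component x⟩, fun x y m => ?_⟩, fun ⟨h, h'⟩ => ?_⟩
  · exact isCommuter_of_isIso (C.component x) (C.component y) (α.src_cell m) (α.tgt_cell m)
      (C.isIso_slide_component m)
  -- Companions are chosen once per object, so that slides at composable proarrows share the
  -- companion in the middle.
  · have : ∀ {x y : D} (m : x ⇸ y), IsIso (α.slide (fun x => (h x).some) m) := fun m =>
      (h' _ _ m).isIso _ _ _ _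
    exact ⟨α.companion fun x => (h x).some⟩

end

/-! ### Conjoints as universal cells, with left and right interchanged -/

namespace Conjoint
variable {D : Type u} [DoubleCategory.{t, w, v} D]

attribute [simp] Conjoint.src_unit Conjoint.tgt_unit Conjoint.src_counit Conjoint.tgt_counit

/-- The cartesian cell `n ⊙ g^* ⟶ n`. -/
def restr {x x' y : D} {f : x ⟶ x'} (c : Conjoint f) (n : y ⇸ x') : Cell (n ⊙ c.pro) n :=
  hcompMap (𝟙 (Loose.mk n)) c.counit (by simp) ≫ (rightUnitor n).hom.cell

/-- The opcartesian cell `m ⟶ f^* ⊙ m`. -/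
def extr {x y y' : D} {g : y ⟶ y'} (c : Conjoint g) (m : y ⇸ x) : Cell m (c.pro ⊙ m) :=
  (leftUnitor m).inv.cell ≫ hcompMap c.unit (𝟙 (Loose.mk m)) (by simp)

/-- Factorization of a cell through `restr`. -/
def lift {x x' y z w : D} {f : x ⟶ x'} (c : Conjoint f) {n : y ⇸ x'} {p : w ⇸ z} (u : z ⟶ x)
    (φ : Cell p n) (h : tgt φ = u ≫ f) : Cell p (n ⊙ c.pro) :=
  (rightUnitor p).inv.cell ≫ hcompMap φ (hidMap u ≫ c.unit) (by simp [h])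

/-- Factorization of a cell through `extr`. -/
def desc {x y y' z w : D} {g : y ⟶ y'} (c : Conjoint g) {m : y ⇸ x} {q : w ⇸ z} (v : y' ⟶ w)
    (φ : Cell m q) (h : src φ = g ≫ v) : Cell (c.pro ⊙ m) q :=
  hcompMap (c.counit ≫ hidMap v) φ (by simp [h]) ≫ (leftUnitor q).hom.cell

section
variable {x x' y z w : D} {f : x ⟶ x'} (c : Conjoint f)

@[simp] theorem src_restr (n : y ⇸ x') : src (c.restr n) = 𝟙 y := by simp [restr]
@[simp] theorem tgt_restr (n : y ⇸ x') : tgt (c.restr n) = f := by simp [restr]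
@[simp] theorem src_extr (m : x ⇸ y) : src (c.extr m) = f := by simp [extr]
@[simp] theorem tgt_extr (m : x ⇸ y) : tgt (c.extr m) = 𝟙 y := by simp [extr]

@[simp] theorem src_lift {n : y ⇸ x'} {p : w ⇸ z} (u : z ⟶ x) (φ : Cell p n)
    (h : tgt φ = u ≫ f) : src (c.lift u φ h) = src φ := by simp [lift]
@[simp] theorem tgt_lift {n : y ⇸ x'} {p : w ⇸ z} (u : z ⟶ x) (φ : Cell p n)
    (h : tgt φ = u ≫ f) : tgt (c.lift u φ h) = u := by simp [lift]
@[simp] theorem src_desc {m : x ⇸ y} {q : w ⇸ z} (v : x' ⟶ w) (φ : Cell m q)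
    (h : src φ = f ≫ v) : src (c.desc v φ h) = v := by simp [desc]
@[simp] theorem tgt_desc {m : x ⇸ y} {q : w ⇸ z} (v : x' ⟶ w) (φ : Cell m q)
    (h : src φ = f ≫ v) : tgt (c.desc v φ h) = tgt φ := by simp [desc]

theorem lift_restr {n : y ⇸ x'} {p : w ⇸ z} (u : z ⟶ x) (φ : Cell p n)
    (h : tgt φ = u ≫ f) : c.lift u φ h ≫ c.restr n = φ := by
  rw [lift, restr, Category.assoc, hcompMap_comp_assoc]
  refine Eq.trans ?_ (rightUnitor_conj φ h)
  refine congrArg (_ ≫ · ≫ _) (hcompMap_congr (Category.comp_id _) ?_)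
  rw [Category.assoc, c.unit_comp_counit, hidMap_comp]

theorem extr_desc {m : x ⇸ y} {q : w ⇸ z} (v : x' ⟶ w) (φ : Cell m q)
    (h : src φ = f ≫ v) : c.extr m ≫ c.desc v φ h = φ := by
  rw [desc, extr, Category.assoc, hcompMap_comp_assoc]
  refine Eq.trans ?_ (leftUnitor_conj φ h)
  refine congrArg (_ ≫ · ≫ _) (hcompMap_congr ?_ (Category.id_comp _))
  rw [← Category.assoc, c.unit_comp_counit, hidMap_comp]

/-- The external law `ε ⊙ η = 1` whiskered by `n`. The triangle here supplies the associator in the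
direction needed, so no inverse pair has to be inserted. -/
theorem restr_hcomp_unit (n : y ⇸ x') :
    (rightUnitor (n ⊙ c.pro)).inv.cell ≫ hcompMap (c.restr n) c.unit (by simp) = 𝟙 _ := by
  have h₁ : hcompMap (c.restr n) c.unit (by simp) =
      hcompMap (hcompMap (𝟙 (Loose.mk n)) c.counit (by simp)) c.unit (by simp) ≫
        hcompMap (rightUnitor n).hom.cell (𝟙 (Loose.mk c.pro)) (by simp) := by
    rw [← hcompMap_comp]
    exact hcompMap_congr rfl (Category.comp_id _).symm
  have h₂ := hassoc_naturality (𝟙 (Loose.mk n)) c.counit c.unit (by simp) (by simp)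
  have h₃ := triangle n c.pro
  rw [h₁, ← h₃, reassoc_of% h₂, reassoc_of% (rightUnitor_hcomp_cell n c.pro),
    ← hcompMap_comp, ← hcompMap_comp]
  exact hcompMap_eq_id (by simp) (by simpa using c.counit_hcomp_unit)

theorem counit_hcomp_extr (m : x ⇸ y) :
    hcompMap c.counit (c.extr m) (by simp) ≫ (leftUnitor (c.pro ⊙ m)).hom.cell = 𝟙 _ := by
  have h₁ : hcompMap c.counit (c.extr m) (by simp) =
      hcompMap (𝟙 (Loose.mk c.pro)) (leftUnitor m).inv.cell (by simp) ≫
      hcompMap c.counit (hcompMap c.unit (𝟙 (Loose.mk m)) (by simp)) (by simp) := by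
    rw [← hcompMap_comp]
    exact hcompMap_congr (Category.id_comp _).symm rfl
  have h₂ := hassoc_inv_naturality c.counit c.unit (𝟙 (Loose.mk m)) (by simp) (by simp)
  have h₃ := triangle_inv c.pro m
  have h₄ : (hassoc (hid x') c.pro m).inv.cell ≫
      hcompMap (leftUnitor c.pro).hom.cell (𝟙 (Loose.mk m)) (frame_glob_id _ m) =
        (leftUnitor (c.pro ⊙ m)).hom.cell :=
    congrArg Glob.cell (Bicategory.leftUnitor_comp (B := UBicat D) c.pro m).symm
  rw [h₁, ← h₄, Category.assoc, ← reassoc_of% h₂, reassoc_of% h₃, ← hcompMap_comp,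
    ← hcompMap_comp]
  exact hcompMap_eq_id (by simpa using c.counit_hcomp_unit) (by simp)

theorem lift_comp_restr {n : y ⇸ x'} {p : w ⇸ z} (ψ : Cell p (n ⊙ c.pro)) :
    c.lift (tgt ψ) (ψ ≫ c.restr n) (by simp) = ψ := by
  rw [lift, hcompMap_comp ψ (hidMap (tgt ψ)) (c.restr n) c.unit (by simp) (by simp),
    ← Category.assoc, rightUnitor_inv_naturality ψ rfl, Category.assoc, restr_hcomp_unit,
    Category.comp_id]

theorem desc_extr_comp {m : x ⇸ y} {q : w ⇸ z} (ψ : Cell (c.pro ⊙ m) q) :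
    c.desc (src ψ) (c.extr m ≫ ψ) (by simp) = ψ := by
  rw [desc, hcompMap_comp c.counit (c.extr m) (hidMap (src ψ)) ψ (by simp) (by simp),
    Category.assoc, leftUnitor_naturality ψ, reassoc_of% (c.counit_hcomp_extr m)]

theorem restr_ext {n : y ⇸ x'} {p : w ⇸ z} {ψ ψ' : Cell p (n ⊙ c.pro)}
    (ht : tgt ψ = tgt ψ') (h : ψ ≫ c.restr n = ψ' ≫ c.restr n) : ψ = ψ' := by
  rw [← c.lift_comp_restr ψ, ← c.lift_comp_restr ψ']
  congr 1

theorem extr_ext {m : x ⇸ y} {q : w ⇸ z} {ψ ψ' : Cell (c.pro ⊙ m) q}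
    (hs : src ψ = src ψ') (h : c.extr m ≫ ψ = c.extr m ≫ ψ') : ψ = ψ' := by
  rw [← c.desc_extr_comp ψ, ← c.desc_extr_comp ψ']
  congr 1

/-- Inserting `ε ⊙ η = 1` recovers `ψ` as `(ε ⬝ id) ⊙ (η ⬝ ψ)`, up to unitors, with `id` on the left
boundary of `ψ`. -/
theorem unit_ext {q : w ⇸ z} {ψ ψ' : Cell c.pro q}
    (hs : src ψ = src ψ') (h : c.unit ≫ ψ = c.unit ≫ ψ') : ψ = ψ' := by
  have key : ∀ ψ : Cell c.pro q, ψ = (rightUnitor c.pro).inv.cell ≫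
      hcompMap (c.counit ≫ hidMap (src ψ)) (c.unit ≫ ψ) (by simp) ≫
        (leftUnitor q).hom.cell := fun ψ => by
    rw [hcompMap_comp c.counit c.unit (hidMap (src ψ)) ψ (by simp) (by simp), Category.assoc,
      leftUnitor_naturality ψ, reassoc_of% c.counit_hcomp_unit]
  rw [key ψ, key ψ']
  exact congrArg (_ ≫ · ≫ _) (hcompMap_congr (by rw [hs]) h)

theorem lift_precomp {n : y ⇸ x'} {a b : D} {p : w ⇸ z} {p' : a ⇸ b} (κ : Cell p' p)
    (u : z ⟶ x) (φ : Cell p n) (h : tgt φ = u ≫ f) :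
    κ ≫ c.lift u φ h = c.lift (tgt κ ≫ u) (κ ≫ φ) (by simp [h]) :=
  c.restr_ext (by simp) (by rw [Category.assoc, lift_restr, lift_restr])

theorem lift_congr {n : y ⇸ x'} {p : w ⇸ z} {u u' : z ⟶ x} {φ φ' : Cell p n}
    {h : tgt φ = u ≫ f} (hu : u = u') (hφ : φ = φ') :
    c.lift u φ h = c.lift u' φ' (by rw [← hu, ← hφ, h]) := by
  subst hu hφ; rfl

theorem hidMap_one_unit : hidMap (𝟙 x) ≫ c.unit = c.unit := by
  rw [hidMap_id, Category.id_comp]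

theorem counit_hidMap_one : c.counit ≫ hidMap (𝟙 x') = c.counit := by
  rw [hidMap_id, Category.comp_id]

theorem lift_one {n : y ⇸ x'} {p : w ⇸ x} (φ : Cell p n) (h : tgt φ = f) :
    c.lift (𝟙 x) φ (by simp [h]) =
      (rightUnitor p).inv.cell ≫ hcompMap φ c.unit (by simp [h]) :=
  congrArg (_ ≫ ·) (hcompMap_congr rfl c.hidMap_one_unit)

theorem desc_one {m : x ⇸ y} {q : x' ⇸ z} (φ : Cell m q) (h : src φ = f) :
    c.desc (𝟙 x') φ (by simp [h]) =
      hcompMap c.counit φ (by simp [h]) ≫ (leftUnitor q).hom.cell :=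
  congrArg (· ≫ _) (hcompMap_congr c.counit_hidMap_one rfl)

end

/-! ### Functoriality of conjoints in commutative squares -/

section
variable {x y x' y' : D} {f : x ⟶ y} {g : x' ⟶ y'} (c : Conjoint f) (d : Conjoint g)

/-- The cell `f^* ⟶ g^*` induced by a commutative square of arrows. -/
def map (u : x ⟶ x') (v : y ⟶ y') (h : u ≫ g = f ≫ v) : Cell c.pro d.pro :=
  (rightUnitor c.pro).inv.cell ≫
    hcompMap (c.counit ≫ hidMap v) (hidMap u ≫ d.unit) (by simp [h]) ≫
      (leftUnitor d.pro).hom.cell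

@[simp] theorem src_map (u : x ⟶ x') (v : y ⟶ y') (h : u ≫ g = f ≫ v) :
    src (c.map d u v h) = v := by simp [map]

@[simp] theorem tgt_map (u : x ⟶ x') (v : y ⟶ y') (h : u ≫ g = f ≫ v) :
    tgt (c.map d u v h) = u := by simp [map]

theorem unit_map (u : x ⟶ x') (v : y ⟶ y') (h : u ≫ g = f ≫ v) :
    c.unit ≫ c.map d u v h = hidMap u ≫ d.unit := by
  rw [map, ← Category.assoc, ← rightUnitor_inv_naturality c.unit c.tgt_unit, Category.assoc,
    hcompMap_comp_assoc]
  refine Eq.trans ?_ (leftUnitor_conj (hidMap u ≫ d.unit) (u := u ≫ g) (by simp))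
  rw [unitors_hid]
  refine congrArg (_ ≫ · ≫ _) (hcompMap_congr ?_ ?_)
  · rw [← Category.assoc, c.unit_comp_counit, h, hidMap_comp]
  · rw [hidMap_id, Category.id_comp]

theorem map_counit (u : x ⟶ x') (v : y ⟶ y') (h : u ≫ g = f ≫ v) :
    c.map d u v h ≫ d.counit = c.counit ≫ hidMap v := by
  have e := leftUnitor_naturality' d.counit d.src_counit
  rw [map, Category.assoc, Category.assoc, ← e, hcompMap_comp_assoc]
  refine Eq.trans ?_ (rightUnitor_conj (c.counit ≫ hidMap v) (v := u ≫ g) (by simp [h]))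
  rw [unitors_hid]
  refine congrArg (_ ≫ · ≫ _) (hcompMap_congr ?_ ?_)
  · rw [hidMap_id, Category.comp_id]
  · rw [Category.assoc, d.unit_comp_counit, hidMap_comp]

end

/-! ### The sliding cell along conjoints -/

section
variable {x y x' y' : D} {m : x ⇸ y} {n : x' ⇸ y'} {f : x ⟶ x'} {g : y ⟶ y'}
  (cf : Conjoint f) (cg : Conjoint g) (α : Cell m n) (hf : src α = f) (hg : tgt α = g)

theorem slideConjoint_eq_desc_lift :
    (slideConjoint cf cg α hf hg).cell =
      cf.desc (𝟙 _) (cg.lift (𝟙 _) α (by simp [hg])) (by simp [hf]) := by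
  have e : hcompMap cf.counit (cg.lift (𝟙 _) α (by simp [hg])) (by simp [hf]) =
      hcompMap (𝟙 (Loose.mk cf.pro)) (rightUnitor m).inv.cell (by simp) ≫
        hcompMap cf.counit (hcompMap α cg.unit (by simp [hg])) (by simp [hf]) := by
    rw [← hcompMap_comp]
    exact hcompMap_congr (Category.id_comp _).symm (cg.lift_one α hg)
  rw [desc_one _ _ (by simp [hf]), e, Category.assoc]
  rfl

theorem extr_slideConjoint :
    cf.extr m ≫ (slideConjoint cf cg α hf hg).cell = cg.lift (𝟙 _) α (by simp [hg]) := by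
  rw [slideConjoint_eq_desc_lift, extr_desc]

theorem slideConjoint_restr :
    (slideConjoint cf cg α hf hg).cell ≫ cg.restr n = cf.desc (𝟙 _) α (by simp [hf]) :=
  cf.extr_ext (by simp) (by
    rw [← Category.assoc, extr_slideConjoint, lift_restr, extr_desc])

/-- Needed only to change the chosen conjoints: in the equivalence itself the comparison is the
slide rather than its inverse. -/
theorem isIso_slideConjoint (T : n ⊙ cg.pro ⟶ cf.pro ⊙ m)
    (h₁ : cg.lift (𝟙 _) α (by simp [hg]) ≫ T.cell = cf.extr m)
    (h₂ : T.cell ≫ cf.desc (𝟙 _) α (by simp [hf]) = cg.restr n) :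
    IsIso (slideConjoint cf cg α hf hg) := by
  refine ⟨T, glob_ext (cf.extr_ext (by simp) ?_), glob_ext (cg.restr_ext (by simp) ?_)⟩
  · rw [glob_comp_cell, ← Category.assoc, extr_slideConjoint, h₁, glob_id_cell, Category.comp_id]
  · rw [glob_comp_cell, Category.assoc, slideConjoint_restr, h₂, glob_id_cell, Category.id_comp]

theorem lift_inv_slideConjoint [IsIso (slideConjoint cf cg α hf hg)] :
    cg.lift (𝟙 _) α (by simp [hg]) ≫ (inv (slideConjoint cf cg α hf hg)).cell = cf.extr m := by
  rw [← extr_slideConjoint cf cg α hf hg, Category.assoc, ← glob_comp_cell, IsIso.hom_inv_id,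
    glob_id_cell, Category.comp_id]

theorem inv_slideConjoint_desc [IsIso (slideConjoint cf cg α hf hg)] :
    (inv (slideConjoint cf cg α hf hg)).cell ≫ cf.desc (𝟙 _) α (by simp [hf]) = cg.restr n := by
  rw [← slideConjoint_restr cf cg α hf hg, ← Category.assoc, ← glob_comp_cell, IsIso.inv_hom_id,
    glob_id_cell, Category.id_comp]

theorem isIso_slideConjoint_of_isIso (cf' : Conjoint f) (cg' : Conjoint g)
    [IsIso (slideConjoint cf cg α hf hg)] : IsIso (slideConjoint cf' cg' α hf hg) := by
  have hf' : src α = f ≫ 𝟙 _ := by simp [hf]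
  refine isIso_slideConjoint cf' cg' α hf hg
    ⟨hcompMap (𝟙 (Loose.mk n)) (cg'.map cg (𝟙 _) (𝟙 _) (by simp)) (by simp) ≫
      (inv (slideConjoint cf cg α hf hg)).cell ≫
      hcompMap (cf.map cf' (𝟙 _) (𝟙 _) (by simp)) (𝟙 (Loose.mk m)) (by simp),
      by simp, by simp⟩ ?_ ?_
  · have e : cg'.lift (𝟙 _) α (by simp [hg]) ≫
        hcompMap (𝟙 (Loose.mk n)) (cg'.map cg (𝟙 _) (𝟙 _) (by simp)) (by simp) =
        cg.lift (𝟙 _) α (by simp [hg]) := by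
      rw [lift_one _ _ hg, lift_one _ _ hg, Category.assoc, ← hcompMap_comp]
      refine congrArg (_ ≫ ·) (hcompMap_congr (Category.comp_id _) ?_)
      rw [unit_map, hidMap_one_unit]
    dsimp only
    rw [reassoc_of% e, ← Category.assoc, lift_inv_slideConjoint, extr, Category.assoc,
      ← hcompMap_comp, extr]
    refine congrArg (_ ≫ ·) (hcompMap_congr ?_ (Category.comp_id _))
    rw [unit_map, hidMap_one_unit]
  · have e : hcompMap (cf.map cf' (𝟙 _) (𝟙 _) (by simp)) (𝟙 (Loose.mk m)) (by simp) ≫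
        cf'.desc (𝟙 _) α hf' = cf.desc (𝟙 _) α hf' := by
      rw [desc_one _ _ hf, desc_one _ _ hf, hcompMap_comp_assoc]
      refine congrArg (· ≫ _) (hcompMap_congr ?_ (Category.id_comp _))
      rw [map_counit, counit_hidMap_one]
    dsimp only
    rw [Category.assoc, Category.assoc, e, inv_slideConjoint_desc, restr, hcompMap_comp_assoc,
      restr]
    refine congrArg (· ≫ _) (hcompMap_congr (Category.comp_id _) ?_)
    rw [map_counit, counit_hidMap_one]

end

/-! ### Naturality and coherence of sliding along conjoints -/

section

theorem extr_hcompMap {x y x' y' z z' : D} {g : y ⟶ z} {g' : y' ⟶ z'} (c : Conjoint g)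
    (c' : Conjoint g') {m : y ⇸ x} {m' : y' ⇸ x'} (γ : Cell m m') (κ : Cell c.pro c'.pro)
    (h : tgt κ = src γ) (hκ : c.unit ≫ κ = hidMap (tgt κ) ≫ c'.unit) :
    c.extr m ≫ hcompMap κ γ h = γ ≫ c'.extr m' := by
  rw [extr, extr, ← Category.assoc, ← leftUnitor_inv_naturality γ h.symm, Category.assoc,
    Category.assoc, ← hcompMap_comp, ← hcompMap_comp]
  exact congrArg (_ ≫ ·) (hcompMap_congr hκ (by simp))

theorem lift_hcompMap {x y x' y' z w z' : D} {f : x ⟶ y} {f' : x' ⟶ y'} (c : Conjoint f)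
    (c' : Conjoint f') {m : z ⇸ x} {n : w ⇸ y} {n' : z' ⇸ y'} (φ : Cell m n) (hφ : tgt φ = f)
    (κ : Cell c.pro c'.pro) (δ : Cell n n') (h : tgt δ = src κ)
    (hκ : c.unit ≫ κ = hidMap (tgt κ) ≫ c'.unit) :
    c.lift (𝟙 x) φ (by simp [hφ]) ≫ hcompMap δ κ h =
      c'.lift (tgt κ) (φ ≫ δ) (by simpa [h, hφ] using congrArg src hκ) := by
  rw [lift_one _ _ hφ, lift, Category.assoc, ← hcompMap_comp]
  exact congrArg (_ ≫ ·) (hcompMap_congr rfl hκ)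

theorem slideConjoint_naturality {x y x' y' a b a' b' : D} {m : x ⇸ y} {n : x' ⇸ y'}
    {p : a ⇸ b} {q : a' ⇸ b'} {f : x ⟶ x'} {g : y ⟶ y'} {f' : a ⟶ a'} {g' : b ⟶ b'}
    (cf : Conjoint f) (cg : Conjoint g) (cf' : Conjoint f') (cg' : Conjoint g')
    (α : Cell m n) (hf : src α = f) (hg : tgt α = g)
    (β : Cell p q) (hf' : src β = f') (hg' : tgt β = g') (γ : Cell m p) (δ : Cell n q)
    (h : γ ≫ β = α ≫ δ) (κ : Cell cf.pro cf'.pro) (κ' : Cell cg.pro cg'.pro)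
    (h₁ : tgt κ = src γ) (h₂ : tgt δ = src κ') (h₃ : src κ = src δ) (h₄ : tgt κ' = tgt γ)
    (hκ : cf.unit ≫ κ = hidMap (tgt κ) ≫ cf'.unit)
    (hκ' : cg.unit ≫ κ' = hidMap (tgt κ') ≫ cg'.unit) :
    (slideConjoint cf cg α hf hg).cell ≫ hcompMap δ κ' h₂ =
      hcompMap κ γ h₁ ≫ (slideConjoint cf' cg' β hf' hg').cell := by
  refine cf.extr_ext (by simp [h₃]) ?_
  have e := lift_hcompMap cg cg' α hg κ' δ h₂ hκ'
  rw [← Category.assoc, extr_slideConjoint, e, ← Category.assoc,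
    extr_hcompMap _ _ _ _ h₁ hκ, Category.assoc, extr_slideConjoint, lift_precomp]
  exact lift_congr _ (by simp [h₄]) h.symm

/-- The boundary now travels from `f^*` through `g^*` to `h^*`. This is already the composition
coherence of a protransformation from `G` to `F`, with no inverses to take. -/
theorem slideConjoint_hcomp {x y z x' y' z' : D} {m : x ⇸ y} {m' : y ⇸ z} {m'' : x ⇸ z}
    {n : x' ⇸ y'} {n' : y' ⇸ z'} {n'' : x' ⇸ z'} {f : x ⟶ x'} {g : y ⟶ y'} {h : z ⟶ z'}
    (cf : Conjoint f) (cg : Conjoint g) (ch : Conjoint h)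
    (α : Cell m n) (hf : src α = f) (hg : tgt α = g)
    (β : Cell m' n') (hf' : src β = g) (hg' : tgt β = h)
    (γ : Cell m'' n'') (hf'' : src γ = f) (hg'' : tgt γ = h)
    (φ : m ⊙ m' ⟶ m'') (ψ : n ⊙ n' ⟶ n'')
    (e : φ.cell ≫ γ = hcompMap α β (hg.trans hf'.symm) ≫ ψ.cell) :
    cf.pro ◁ₚ φ ≫ slideConjoint cf ch γ hf'' hg'' =
      (hassoc _ _ _).inv ≫ slideConjoint cf cg α hf hg ▷ₚ m' ≫ (hassoc _ _ _).hom ≫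
        n ◁ₚ slideConjoint cg ch β hf' hg' ≫ (hassoc _ _ _).inv ≫ ψ ▷ₚ ch.pro := by
  have e₁ : cf.extr (m ⊙ m') ≫ (hassoc _ _ _).inv.cell =
      hcompMap (cf.extr m) (𝟙 (Loose.mk m')) (by simp) := by
    have h := hassoc_inv_naturality cf.unit (𝟙 (Loose.mk m)) (𝟙 (Loose.mk m')) (by simp) (by simp)
    rw [extr, hcompMap_congr rfl (hcompMap_id m m').symm, Category.assoc, ← h,
      reassoc_of% (leftUnitor_hcomp_cell m m'), ← hcompMap_comp]
    exact hcompMap_congr rfl (by simp)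
  -- The unit of `g^*` between `α` and `m'` is reattached from the first factor, as a lift of `α`,
  -- to the second, as an extension of `m'`.
  have e₂ : hcompMap (cg.lift (𝟙 _) α (by simp [hg])) (𝟙 (Loose.mk m')) (by simp) ≫
      (hassoc _ _ _).hom.cell = hcompMap α (cg.extr m') (by simp [hg]) := by
    have h := hassoc_naturality α cg.unit (𝟙 (Loose.mk m')) (by simp [hg]) (by simp)
    have e : hcompMap (cg.lift (𝟙 _) α (by simp [hg])) (𝟙 (Loose.mk m')) (by simp) =
        hcompMap (rightUnitor m).inv.cell (𝟙 (Loose.mk m')) (by simp) ≫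
        hcompMap (hcompMap α cg.unit (by simp [hg])) (𝟙 (Loose.mk m')) (by simp) := by
      rw [← hcompMap_comp]
      exact hcompMap_congr (lift_one _ _ hg) (Category.comp_id _).symm
    rw [e, Category.assoc, h, reassoc_of% (triangle_inv' m m'), ← hcompMap_comp]
    exact hcompMap_congr (by simp) rfl
  have e₃ : hcompMap α (ch.lift (𝟙 _) β (by simp [hg'])) (by simp [hg, hf']) ≫
      (hassoc _ _ _).inv.cell =
      ch.lift (𝟙 _) (hcompMap α β (hg.trans hf'.symm)) (by simp [hg']) := by
    have h := hassoc_inv_naturality α β ch.unit (by simp [hg, hf']) (by simp [hg'])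
    have e : hcompMap α (ch.lift (𝟙 _) β (by simp [hg'])) (by simp [hg, hf']) =
        hcompMap (𝟙 (Loose.mk m)) (rightUnitor m').inv.cell (by simp) ≫
        hcompMap α (hcompMap β ch.unit (by simp [hg'])) (by simp [hg, hf']) := by
      rw [← hcompMap_comp]
      exact hcompMap_congr (Category.id_comp _).symm (lift_one _ _ hg')
    rw [e, Category.assoc, ← h, ← rightUnitor_hcomp_cell, Category.assoc,
      iso_hom_inv_cell_assoc, lift_one _ _ (by simp [hg'])]
  have e₄ := lift_hcompMap ch ch (hcompMap α β (hg.trans hf'.symm)) (by simp [hg']) (𝟙 _) ψ.cell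
    (by simp) (by simp [hidMap_id])
  refine glob_ext (cf.extr_ext (by simp) ?_)
  simp only [glob_comp_cell, whiskerL, whiskerR]
  rw [← Category.assoc, extr_hcompMap cf cf φ.cell (𝟙 _) (by simp) (by simp [hidMap_id]),
    Category.assoc, extr_slideConjoint, lift_precomp, reassoc_of% e₁, hcompMap_comp_assoc]
  rw [hcompMap_congr (extr_slideConjoint cf cg α hf hg) (Category.comp_id _), reassoc_of% e₂,
    hcompMap_comp_assoc,
    hcompMap_congr (Category.comp_id _) (extr_slideConjoint cg ch β hf' hg'), reassoc_of% e₃, e₄]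
  exact lift_congr _ (by simp) e

theorem slideConjoint_hid {x y : D} {f : x ⟶ y} (c : Conjoint f) {m : x ⇸ x} {n : y ⇸ y}
    (α : Cell m n) (hf : src α = f) (hg : tgt α = f) (φ : hid x ⟶ m) (ψ : hid y ⟶ n)
    (e : φ.cell ≫ α = hidMap f ≫ ψ.cell) :
    c.pro ◁ₚ φ ≫ slideConjoint c c α hf hg =
      (rightUnitor _).hom ≫ (leftUnitor _).inv ≫ ψ ▷ₚ c.pro := by
  refine glob_ext (c.extr_ext (by simp) ?_)
  simp only [glob_comp_cell, whiskerL, whiskerR]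
  rw [← Category.assoc, extr_hcompMap c c φ.cell (𝟙 _) (by simp) (by simp [hidMap_id]),
    Category.assoc, extr_slideConjoint, lift_precomp]
  have e₁ : c.extr (hid x) ≫ (rightUnitor c.pro).hom.cell = c.unit := by
    rw [extr, unitors_hid, hcompMap_congr rfl (hidMap_id x).symm, Category.assoc,
      rightUnitor_conj _ c.tgt_unit]
  rw [reassoc_of% e₁, ← reassoc_of% (leftUnitor_inv_naturality c.unit c.src_unit),
    ← hcompMap_comp]
  refine (lift_congr c (u' := 𝟙 x) (by simp) e).trans ?_
  rw [lift_one _ _ (by simp), unitors_hid]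
  exact congrArg (_ ≫ ·) (hcompMap_congr rfl (by simp))

end
end Conjoint

theorem IsCocommuter.isIso {D : Type u} [DoubleCategory.{t, w, v} D] {x y x' y' : D}
    {m : x ⇸ y} {n : x' ⇸ y'} {α : Cell m n} (hα : IsCocommuter α) {f : x ⟶ x'} {g : y ⟶ y'}
    (cf : Conjoint f) (cg : Conjoint g) (hf : src α = f) (hg : tgt α = g) :
    IsIso (slideConjoint cf cg α hf hg) := by
  subst hf hg
  exact hα.2.2 cf cg

theorem isCocommuter_of_isIso {D : Type u} [DoubleCategory.{t, w, v} D] {x y x' y' : D}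
    {m : x ⇸ y} {n : x' ⇸ y'} {α : Cell m n} {f : x ⟶ x'} {g : y ⟶ y'}
    (cf : Conjoint f) (cg : Conjoint g) (hf : src α = f) (hg : tgt α = g)
    (h : IsIso (slideConjoint cf cg α hf hg)) : IsCocommuter α := by
  subst hf hg
  exact ⟨⟨cf⟩, ⟨cg⟩, fun cf' cg' =>
    Conjoint.isIso_slideConjoint_of_isIso cf cg α rfl rfl cf' cg'⟩

/-! ### The conjoint of a natural transformation from componentwise conjoints -/

section
variable {D : Type u₁} [DoubleCategory.{t₁, w₁, v₁} D]
variable {E : Type u₂} [DoubleCategory.{t₂, w₂, v₂} E]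
variable {F G : LaxDoubleFunctor D E} (α : NatTransf F G)

namespace NatTransf

/-- The globular cell obtained from a component cell of `α` by sliding along conjoints. -/
abbrev coslide (c : ∀ x, Conjoint (α.app x)) {x y : D} (m : x ⇸ y) :
    (c x).pro ⊙ F.mapPro m ⟶ G.mapPro m ⊙ (c y).pro :=
  slideConjoint (c x) (c y) (α.cell m) (α.src_cell m) (α.tgt_cell m)

variable (c : ∀ x, Conjoint (α.app x))
  [hc : ∀ {x y : D} (m : x ⇸ y), IsIso (α.coslide c m)]

/-- The pseudo protransformation `G ⇸ F` with components the conjoints of those of `α`. -/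
def conjointProtransf : PseudoProtransf G F where
  pro x := (c x).pro
  arr {x y} f := (c x).map (c y) (F.map f) (G.map f) (α.naturality f)
  src_arr f := by simp
  tgt_arr f := by simp
  -- The slide already has the direction of a comparison for `G ⇸ F`; invertibility serves only to
  -- make the protransformation pseudo.
  comparison m := α.coslide c m
  isIso_comparison m := inferInstance
  arr_id x := (c x).unit_ext (by simp) (by
    rw [Conjoint.unit_map, F.map_id, hidMap_id, Category.id_comp, Category.comp_id])
  arr_comp {x y z} f g := (c x).unit_ext (by simp) (by
    rw [Conjoint.unit_map, reassoc_of% ((c x).unit_map (c y)), Conjoint.unit_map, F.map_comp,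
      hidMap_comp, Category.assoc])
  naturality {x y x' y' m n} γ :=
    Conjoint.slideConjoint_naturality (c x) (c y) (c x') (c y') (α.cell m)
      (α.src_cell m) (α.tgt_cell m) (α.cell n) (α.src_cell n) (α.tgt_cell n)
      (F.mapCell γ) (G.mapCell γ) (α.cell_naturality γ)
      ((c x).map (c x') (F.map (src γ)) (G.map (src γ)) (α.naturality _))
      ((c y).map (c y') (F.map (tgt γ)) (G.map (tgt γ)) (α.naturality _))
      (by simp) (by simp) (by simp) (by simp) (by simp [Conjoint.unit_map])
      (by simp [Conjoint.unit_map])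
  comparison_hcomp {x y z} m n :=
    Conjoint.slideConjoint_hcomp (c x) (c y) (c z) (α.cell m) (α.src_cell m)
      (α.tgt_cell m) (α.cell n) (α.src_cell n) (α.tgt_cell n) (α.cell (m ⊙ n))
      (α.src_cell _) (α.tgt_cell _) (F.laxComp m n) (G.laxComp m n) (α.cell_hcomp m n)
  comparison_hid x :=
    Conjoint.slideConjoint_hid (c x) (α.cell (hid x)) (α.src_cell _) (α.tgt_cell _)
      (F.laxId x) (G.laxId x) (α.cell_hid x)

/-- The conjoint of `α` with components the conjoints of those of `α`. -/
def conjoint : Conjoint (D := LaxPs D E) (x := F) (y := G) α where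
  pro := α.conjointProtransf c
  unit :=
    { left := α
      right := 𝟙 F
      app := fun x => (c x).unit
      src_app := fun x => (c x).src_unit
      tgt_app := fun x => (c x).tgt_unit
      arr_equivariance := fun {x y} f => (c x).unit_map (c y) _ _ (α.naturality f)
      pro_equivariance := fun {x y} m => by
        have h := Conjoint.extr_slideConjoint (c x) (c y) (α.cell m) (α.src_cell m)
          (α.tgt_cell m)
        rw [Conjoint.lift_one _ _ (α.tgt_cell m), Conjoint.extr, Category.assoc] at h
        refine (iso_hom_inv_cell_assoc (leftUnitor (F.mapPro m)) _).symm.trans ?_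
        exact (congrArg (_ ≫ ·) h).trans (Category.assoc _ _ _).symm }
  src_unit := rfl
  tgt_unit := rfl
  counit :=
    { left := 𝟙 G
      right := α
      app := fun x => (c x).counit
      src_app := fun x => (c x).src_counit
      tgt_app := fun x => (c x).tgt_counit
      arr_equivariance := fun {x y} f => ((c x).map_counit (c y) _ _ (α.naturality f)).symm
      pro_equivariance := fun {x y} m => by
        have h := Conjoint.slideConjoint_restr (c x) (c y) (α.cell m) (α.src_cell m)
          (α.tgt_cell m)
        rw [Conjoint.desc_one _ _ (α.src_cell m)] at h
        refine (Category.assoc _ _ _).symm.trans ((congrArg (· ≫ _) h.symm).trans ?_)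
        refine (Category.assoc _ _ _).trans (congrArg (_ ≫ ·) ?_)
        refine (Category.assoc _ _ _).trans ?_
        exact (congrArg (_ ≫ ·) (iso_hom_inv_cell _)).trans (Category.comp_id _) }
  src_counit := rfl
  tgt_counit := rfl
  counit_hcomp_unit := Modif.ext' ((Category.id_comp _).trans (Category.comp_id _))
    ((Category.id_comp _).trans (Category.comp_id _)) (fun x => (c x).counit_hcomp_unit)
  unit_comp_counit := Modif.ext' (Category.comp_id _) (Category.id_comp _)
    (fun x => (c x).unit_comp_counit)

end NatTransf

/-! ### Components of a conjoint, and the second equivalence -/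

variable {α}

/-- The component at `x` of a conjoint in `LaxPs D E`. -/
def Conjoint.component (C : Conjoint (D := LaxPs D E) (x := F) (y := G) α) (x : D) :
    Conjoint (α.app x) where
  pro := (LaxPs.toProtransf C.pro).pro x
  unit := Modif.app C.unit x
  src_unit := (Modif.src_app C.unit x).trans
    (congrArg (fun β : NatTransf F G => β.app x) C.src_unit)
  tgt_unit := (Modif.tgt_app C.unit x).trans
    (congrArg (fun β : NatTransf F F => β.app x) C.tgt_unit)
  counit := Modif.app C.counit x
  src_counit := (Modif.src_app C.counit x).trans
    (congrArg (fun β : NatTransf G G => β.app x) C.src_counit)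
  tgt_counit := (Modif.tgt_app C.counit x).trans
    (congrArg (fun β : NatTransf F G => β.app x) C.tgt_counit)
  counit_hcomp_unit := congrArg (fun μ => Modif.app μ x) C.counit_hcomp_unit
  unit_comp_counit := congrArg (fun μ => Modif.app μ x) C.unit_comp_counit

/-- Equivariance of the unit gives the comparison the same composite with `extr` as the slide, and
opcartesianness forces equality. Equivariance of the counit plays no role. -/
theorem Conjoint.coslide_component (C : Conjoint (D := LaxPs D E) (x := F) (y := G) α)
    {x y : D} (m : x ⇸ y) :
    α.coslide C.component m = (LaxPs.toProtransf C.pro).comparison m := by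
  refine glob_ext ((C.component x).extr_ext ((Glob.src_cell _).trans (Glob.src_cell _).symm) ?_)
  rw [extr_slideConjoint, lift_one _ _ (α.tgt_cell m)]
  have h := Modif.pro_equivariance C.unit m
  have h₁ : (Modif.left C.unit).cell m = α.cell m :=
    congrArg (fun β : NatTransf F G => β.cell m) C.src_unit
  have h₂ : (Modif.right C.unit).cell m = 𝟙 _ :=
    congrArg (fun β : NatTransf F F => β.cell m) C.tgt_unit
  rw [hcompMap_congr rfl h₂, hcompMap_congr h₁ rfl] at h
  rw [extr, Category.assoc]
  refine Eq.trans ?_ (congrArg (_ ≫ ·) (h.trans (Category.assoc _ _ _))).symm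
  exact (iso_inv_hom_cell_assoc (leftUnitor (F.mapPro m)) _).symm

variable (α) in
theorem hasConjoint_iff : HasConjoint (D := LaxPs D E) (x := F) (y := G) α ↔
    (∀ x : D, HasConjoint (α.app x)) ∧ ∀ (x y : D) (m : x ⇸ y), IsCocommuter (α.cell m) := by
  refine ⟨fun ⟨C⟩ => ⟨fun x => ⟨C.component x⟩, fun x y m => ?_⟩, fun ⟨h, h'⟩ => ?_⟩
  · have hm := (LaxPs.toProtransf C.pro).isIso_comparison m
    rw [← C.coslide_component m] at hm
    exact isCocommuter_of_isIso (C.component x) (C.component y) (α.src_cell m) (α.tgt_cell m) hm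
  · have : ∀ {x y : D} (m : x ⇸ y), IsIso (α.coslide (fun x => (h x).some) m) := fun m =>
      (h' _ _ m).isIso _ _ _ _
    exact ⟨α.conjoint fun x => (h x).some⟩

end

end DoubleCat

theorem mainTheorem5
    {D : Type u₁} [DoubleCategory.{t₁, w₁, v₁} D]
    {E : Type u₂} [DoubleCategory.{t₂, w₂, v₂} E]
    (F G : LaxDoubleFunctor D E) (α : NatTransf F G) :
    (HasCompanion (D := LaxPs D E) (x := F) (y := G) α ↔
      (∀ x : D, HasCompanion (α.app x)) ∧
        ∀ (x y : D) (m : x ⇸ y), IsCommuter (α.cell m)) ∧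
    (HasConjoint (D := LaxPs D E) (x := F) (y := G) α ↔
      (∀ x : D, HasConjoint (α.app x)) ∧
        ∀ (x y : D) (m : x ⇸ y), IsCocommuter (α.cell m)) :=
  ⟨hasCompanion_iff α, hasConjoint_iff α⟩
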